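/- Theorem (Characterization of support measures). Let $d\ge 0$. A polyhedral cone in $\mathbb{R}^d$ is an intersection of finitely many closed half-spaces $\{x:\langle a,x\rangle\le 0\}$; let $\mathcal P(\mathbb{R}^d)$ be the set of these cones. For $C\in\mathcal P(\mathbb{R}^d)$ let $C^\circ=\{z:\langle x,z\rangle\le 0\ \forall x\in C\}$ be its polar cone and $$BL(C)=\{(x,z)\in C\times C^\circ:\langle x,z\rangle=0\}$$ its biconic lift. Let $\hat{\mathscr B}$ be the biconic $\sigma$-algebra of all Borel sets $M\subseteq\mathbb{R}^d\times\mathbb{R}^d$ with $\{(\lambda x,\lambda' x'):(x,x')\in M\}=M$ for all $\lambda,\lambda'>0$; a biconic measure is a $\sigma$-additive function $\hat{\mathscr B}\to\mathbb{R}$. For $Q\in O(d)$ put $QM=\{(Qx,Qx'):(x,x')\in M\}$. Let $\hat\Delta$ be the Dirac measure at $(0,0)$ on $\hat{\mathscr B}$. A face of $C$ is a set $\{x\in C:\langle x,z\rangle=0\}$ with $z\in C^\circ$; its dimension is that of its linear span. For $0\le k\le d$ let $S_k(C)$ be the union, over the $k$-dimensional faces $F$ of $C$, of the interior of $F$ relative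 to its linear span. With $\Pi_C$ and $\Pi_{C^\circ}$ the nearest-point maps onto $C$ and $C^\circ$ and $g$ a standard Gaussian vector in $\mathbb{R}^d$, the support measures are $$\Theta_k(C,M)=\mathbb{P}\{\Pi_C(g)\in S_k(C)\text{ and }(\Pi_C(g),\Pi_{C^\circ}(g))\in M\}\qquad(M\in\hat{\mathscr B}).$$ Let $\psi:\mathcal P(\mathbb{R}^d)\times\hat{\mathscr B}\to\mathbb{R}$ be such that for all $C,D\in\mathcal P(\mathbb{R}^d)$, $M\in\hat{\mathscr B}$ and $Q\in O(d)$: (0) $\psi(C,\cdot)$ is a biconic measure; (1) $\psi(C,M)=\psi(C,M\cap BL(C))$; (2) $\psi(QC,QM)=\psi(C,M)$; (3) $\psi(C,M)=\psi(D,M)$ whenever $BL(C)\cap M=BL(D)\cap M$. Then $\psi$ is a linear combination of $\hat\Delta$ and $\Theta_0,\dots,\Theta_d$ (with coefficients independent of $C$). More precisely, for any linear subspaces $L^{(k)}\subseteq\mathbb{R}^d$ with $\dim L^{(k)}=k$, $0\le k\le d$, and for all $C\in\mathcal P(\mathbb{R}^d)$ and $M\in\hat{\mathscr B}$, $$\psi(C,M)=\psi\big(\mathbb{R}^d,\{(0,0)\}\big)\,\hat\Delta(M)+\sum_{k=0}^d\psi\big(L^{(k)},(\mathbb{R}^d\times\mathbb{R}^d)\setminus\{(0,0)\}\big)\,\Theta_k(C,M).$$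 -/

import Mathlib

open MeasureTheory ProbabilityTheory

/-! ### Polyhedral cones -/

/-- The Euclidean space `ℝ^d`. -/
abbrev Euc (d : ℕ) : Type := EuclideanSpace ℝ (Fin d)

/-- A polyhedral cone in `ℝ^d`: an intersection of finitely many closed linear half-spaces,
`C = {x | ⟪a i, x⟫ ≤ 0 for all i}`. -/
def IsPolyhedralCone {d : ℕ} (C : Set (Euc d)) : Prop :=
  ∃ (m : ℕ) (a : Fin m → Euc d), C = {x | ∀ i, inner ℝ (a i) x ≤ 0}

/-- The set `P(ℝ^d)` of polyhedral cones. -/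
def PolyCone (d : ℕ) : Type := {C : Set (Euc d) // IsPolyhedralCone C}

/-- The underlying set of a polyhedral cone. -/
def PolyCone.carrier {d : ℕ} (C : PolyCone d) : Set (Euc d) := C.1

theorem IsPolyhedralCone.image {d : ℕ} {C : Set (Euc d)} (hC : IsPolyhedralCone C)
    (Q : Euc d ≃ₗᵢ[ℝ] Euc d) : IsPolyhedralCone (Q '' C) := by
  obtain ⟨m, a, rfl⟩ := hC
  refine ⟨m, fun i => Q (a i), ?_⟩
  ext y
  constructor
  · rintro ⟨x, hx, rfl⟩ i
    simpa using hx i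
  · intro hy
    refine ⟨Q.symm y, fun i => ?_, by simp⟩
    have h := hy i
    rw [← Q.apply_symm_apply y, Q.inner_map_map] at h
    exact h

theorem isPolyhedralCone_submodule {d : ℕ} (L : Submodule ℝ (Euc d)) :
    IsPolyhedralCone (L : Set (Euc d)) := by
  obtain ⟨n, s, hs⟩ := Submodule.fg_iff_exists_fin_generating_family.mp
    (IsNoetherian.noetherian Lᗮ)
  refine ⟨n + n, Fin.append s (-s), ?_⟩
  have key : ∀ x, x ∈ L ↔ ∀ i, inner ℝ (s i) x = 0 := by
    intro x
    rw [← Submodule.orthogonal_orthogonal L, Submodule.mem_orthogonal, ← hs]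
    constructor
    · intro h i
      exact h _ (Submodule.subset_span ⟨i, rfl⟩)
    · intro h u hu
      induction hu using Submodule.span_induction with
      | mem u hu => obtain ⟨i, rfl⟩ := hu; exact h i
      | zero => simp
      | add u v _ _ h1 h2 => rw [inner_add_left, h1, h2, add_zero]
      | smul c u _ h1 => rw [real_inner_smul_left, h1, mul_zero]
  ext x
  rw [SetLike.mem_coe, key]
  constructor
  · intro h i
    refine Fin.addCases (fun j => ?_) (fun j => ?_) i
    · rw [Fin.append_left, h j]
    · rw [Fin.append_right, Pi.neg_apply, inner_neg_left, h j, neg_zero]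
  · intro h i
    have h1 := h (Fin.castAdd n i)
    have h2 := h (Fin.natAdd n i)
    simp only [Fin.append_left, Fin.append_right, Pi.neg_apply, inner_neg_left] at h1 h2
    linarith

/-- The rotated cone `Q C` for an orthogonal transformation `Q`. -/
def PolyCone.map {d : ℕ} (Q : Euc d ≃ₗᵢ[ℝ] Euc d) (C : PolyCone d) : PolyCone d :=
  ⟨Q '' C.carrier, C.2.image Q⟩

/-- A linear subspace as a polyhedral cone. -/
def PolyCone.ofSubspace {d : ℕ} (L : Submodule ℝ (Euc d)) : PolyCone d :=
  ⟨L, isPolyhedralCone_submodule L⟩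

/-- The polar cone `C° = {z | ⟪x, z⟫ ≤ 0 for all x ∈ C}`, as a set. -/
def polarCone {d : ℕ} (C : Set (Euc d)) : Set (Euc d) :=
  {z | ∀ x ∈ C, inner ℝ x z ≤ 0}

/-- `F` is a face of `C`: `F = {x ∈ C | ⟪x, z⟫ = 0}` for some `z` with `⟪x, z⟫ ≤ 0` on `C`. -/
def IsConeFace {d : ℕ} (C F : Set (Euc d)) : Prop :=
  ∃ z : Euc d, (∀ x ∈ C, inner ℝ x z ≤ 0) ∧ F = {x ∈ C | inner ℝ x z = 0}

/-- `𝓛_k(C)`, the set of linear spans of the `k`-dimensional faces of `C`. -/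
def faceSpans {d : ℕ} (C : Set (Euc d)) (k : ℕ) : Set (Submodule ℝ (Euc d)) :=
  {L | ∃ F, IsConeFace C F ∧ L = Submodule.span ℝ F ∧ Module.finrank ℝ L = k}

/-- `int_L (C ∩ L)`, the interior of `C ∩ L` in the relative topology of the subspace `L`. -/
def interiorIn {d : ℕ} (L : Submodule ℝ (Euc d)) (C : Set (Euc d)) : Set (Euc d) :=
  Subtype.val '' interior {x : L | (x : Euc d) ∈ C}

/-- The `k`-skeleton `S_k(C)`, the union of the relative interiors of the `k`-dimensional faces. -/
def skeleton {d : ℕ} (C : Set (Euc d)) (k : ℕ) : Set (Euc d) :=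
  ⋃ L ∈ faceSpans C k, interiorIn L C

/-- `y` is a point of `C` nearest to `x`. -/
def IsNearestPoint {d : ℕ} (C : Set (Euc d)) (x y : Euc d) : Prop :=
  y ∈ C ∧ ∀ z ∈ C, ‖x - y‖ ≤ ‖x - z‖

/-- The metric projection `Π_C`, the (unique) nearest point of `C`; it is used only for closed
convex cones `C`, where `nearestPt_spec` and `IsNearestPoint.eq_nearestPt` apply. -/
noncomputable def nearestPt {d : ℕ} (C : Set (Euc d)) (x : Euc d) : Euc d :=
  Classical.epsilon (IsNearestPoint C x)

theorem nearestPt_spec {d : ℕ} {C : Set (Euc d)} (hC : IsClosed C) (hne : C.Nonempty)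
    (x : Euc d) : IsNearestPoint C x (nearestPt C x) := by
  apply Classical.epsilon_spec (p := IsNearestPoint C x)
  obtain ⟨y, hy, h⟩ := hC.exists_infDist_eq_dist hne x
  refine ⟨y, hy, fun z hz => ?_⟩
  rw [← dist_eq_norm, ← dist_eq_norm, ← h]
  exact Metric.infDist_le_dist_of_mem hz

theorem IsNearestPoint.eq_nearestPt {d : ℕ} {C : Set (Euc d)} (hC : IsClosed C)
    (hconv : Convex ℝ C) {x y : Euc d} (hy : IsNearestPoint C x y) : y = nearestPt C x := by
  obtain ⟨hw, hwmin⟩ := nearestPt_spec hC ⟨y, hy.1⟩ x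
  generalize nearestPt C x = w at hw hwmin
  have hm : (1 / 2 : ℝ) • y + (1 / 2 : ℝ) • w ∈ C :=
    hconv hy.1 hw (by norm_num) (by norm_num) (by norm_num)
  have e1 : ‖x - y‖ = ‖x - w‖ := le_antisymm (hy.2 w hw) (hwmin y hy.1)
  have e2 := hy.2 _ hm
  have e3 : x - ((1 / 2 : ℝ) • y + (1 / 2 : ℝ) • w) = (1 / 2 : ℝ) • ((x - y) + (x - w)) := by
    module
  rw [e3, norm_smul, Real.norm_of_nonneg (by norm_num)] at e2
  have e4 := parallelogram_law_with_norm ℝ (x - y) (x - w)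
  have e5 : (x - y) - (x - w) = w - y := by abel
  rw [e5, ← e1] at e4
  have e6 : ‖w - y‖ = 0 := by
    nlinarith [norm_nonneg (w - y), norm_nonneg (x - y), norm_nonneg ((x - y) + (x - w))]
  exact (sub_eq_zero.mp (norm_eq_zero.mp e6)).symm

/-! ### Biconic sets and measures -/

/-- The map `(x, x') ↦ (s x, t x')`, acting on sets `M ⊆ ℝ^d × ℝ^d`. -/
def biscale {d : ℕ} (s t : ℝ) (M : Set (Euc d × Euc d)) : Set (Euc d × Euc d) :=
  (fun p => (s • p.1, t • p.2)) '' M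

theorem biscale_bijective {d : ℕ} {s t : ℝ} (hs : 0 < s) (ht : 0 < t) :
    Function.Bijective (fun p : Euc d × Euc d => (s • p.1, t • p.2)) := by
  refine ⟨fun p q h => ?_, fun q => ⟨(s⁻¹ • q.1, t⁻¹ • q.2), ?_⟩⟩
  · simp only [Prod.mk.injEq] at h
    exact Prod.ext (smul_right_injective _ hs.ne' h.1) (smul_right_injective _ ht.ne' h.2)
  · simp [smul_smul, hs.ne', ht.ne']

/-- The biconic (Borel) `σ`-algebra on `ℝ^d × ℝ^d`: the Borel sets `M` with `(s, t) M = M`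
for all `s, t > 0`. -/
abbrev biconicAlgebra (d : ℕ) : MeasurableSpace (Euc d × Euc d) where
  MeasurableSet' M := MeasurableSet M ∧ ∀ s t : ℝ, 0 < s → 0 < t → biscale s t M = M
  measurableSet_empty := ⟨MeasurableSet.empty, fun _ _ _ _ => Set.image_empty _⟩
  measurableSet_compl M hM := ⟨hM.1.compl, fun s t hs ht => by
    have h := hM.2 s t hs ht
    unfold biscale at h ⊢
    rw [Set.image_compl_eq (biscale_bijective hs ht), h]⟩
  measurableSet_iUnion f hf := ⟨MeasurableSet.iUnion fun i => (hf i).1, fun s t hs ht => by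
    unfold biscale
    rw [Set.image_iUnion]
    exact Set.iUnion_congr fun i => (hf i).2 s t hs ht⟩

/-- Membership in the biconic `σ`-algebra. -/
def IsBiconic {d : ℕ} (M : Set (Euc d × Euc d)) : Prop :=
  MeasurableSet[biconicAlgebra d] M

/-- Biconic measures: `σ`-additive real-valued functions on the biconic `σ`-algebra. -/
abbrev BiconicMeasure (d : ℕ) : Type :=
  @SignedMeasure (Euc d × Euc d) (biconicAlgebra d)

/-- The biconic lift `{(x, z) ∈ C × C° | ⟪x, z⟫ = 0}`. -/
def biconicLift {d : ℕ} (C : PolyCone d) : Set (Euc d × Euc d) :=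
  {p | p.1 ∈ C.carrier ∧ p.2 ∈ polarCone C.carrier ∧ inner ℝ p.1 p.2 = 0}

/-- The simultaneous action `Q M = {(Q x, Q x') | (x, x') ∈ M}` of an orthogonal map. -/
def biRotate {d : ℕ} (Q : Euc d ≃ₗᵢ[ℝ] Euc d) (M : Set (Euc d × Euc d)) :
    Set (Euc d × Euc d) :=
  (fun p => (Q p.1, Q p.2)) '' M

/-- The biconic Dirac measure supported at the origin. -/
noncomputable def biDirac {d : ℕ} (M : Set (Euc d × Euc d)) : ℝ :=
  (Measure.dirac (0 : Euc d × Euc d)).real M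

/-- The support measure
`Θ_k(C, M) = ℙ(Π_C(g) ∈ S_k(C) and (Π_C(g), Π_{C°}(g)) ∈ M)`, with `g` standard Gaussian. -/
noncomputable def supportMeasure {d : ℕ} (k : ℕ) (C : PolyCone d)
    (M : Set (Euc d × Euc d)) : ℝ :=
  (stdGaussian (Euc d)).real
    {g | nearestPt C.carrier g ∈ skeleton C.carrier k ∧
      (nearestPt C.carrier g, nearestPt (polarCone C.carrier) g) ∈ M}

/-! ### Uniqueness of measures invariant under the stabiliser of a subspace -/

section InvariantMeasures

variable {E : Type*} [NormedAddCommGroup E] [InnerProductSpace ℝ E] [FiniteDimensional ℝ E]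

/-! The relative interiors of the faces partition `C`. If `x` is in the relative interior of a face
with span `L`, and `(x, z)` is in the biconic lift, then `z ∈ Lᗮ`. So the part of the lift over that
face lies in `L × Lᗮ`, the biconic lift of `L` itself, and locality replaces `C` by `L` there. It
remains to know the measure of a subspace, the origin aside.

That measure is invariant under the stabiliser of `L` in the orthogonal group, which is transitive
on pairs of unit vectors of `L` and `Lᗮ`. On pairs with no avoidable zero component it is therefore
a multiple of the law of the two projections of a Gaussian vector
(`BiconicMeasure.eq_mul_of_subset_genericPairs`). A pair `(0, z)` also belongs to the lift of `{0}`,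
and `(x, 0)` to that of the whole space. Locality and the same formula there compare these
degenerate pairs with Gaussian null sets, proper subspaces, so they carry no mass
(`subspace_disjoint_generic`).

By the Moreau decomposition the two projections of `g` form a pair of the lift over a given face
exactly when they are the nearest points of `g` in `C` and its polar, the former interior to that
face (`orthogonalSplit_mem_iff`). Summing over the faces of dimension `k` gives `Θ_k`; by rotation
invariance the coefficient depends on `k` only. The origin lies in every lift and contributes the
Dirac term. -/

theorem map_eq_of_forall_mem {L : Submodule ℝ E} {Q : E ≃ₗᵢ[ℝ] E} (hQ : ∀ x ∈ L, Q x ∈ L) :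
    L.map (Q.toLinearEquiv : E →ₗ[ℝ] E) = L := by
  refine Submodule.eq_of_le_of_finrank_eq ?_ (Q.toLinearEquiv.finrank_map_eq L)
  rintro _ ⟨x, hx, rfl⟩
  exact hQ x hx

theorem apply_mem_orthogonal {L : Submodule ℝ E} {Q : E ≃ₗᵢ[ℝ] E} (hQ : ∀ x ∈ L, Q x ∈ L)
    {z : E} (hz : z ∈ Lᗮ) : Q z ∈ Lᗮ := by
  rw [Submodule.mem_orthogonal] at hz ⊢
  intro w hw
  rw [← map_eq_of_forall_mem hQ] at hw
  obtain ⟨x, hx, rfl⟩ := hw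
  exact (Q.inner_map_map x z).trans (hz x hx)

theorem symm_apply_mem {L : Submodule ℝ E} {Q : E ≃ₗᵢ[ℝ] E} (hQ : ∀ x ∈ L, Q x ∈ L)
    {x : E} (hx : x ∈ L) : Q.symm x ∈ L := by
  rw [← map_eq_of_forall_mem hQ] at hx
  obtain ⟨y, hy, rfl⟩ := hx
  simpa using hy

theorem starProjection_apply_comm {L : Submodule ℝ E} {Q : E ≃ₗᵢ[ℝ] E}
    (hQ : ∀ x ∈ L, Q x ∈ L) (x : E) : L.starProjection (Q x) = Q (L.starProjection x) := by
  refine Submodule.eq_starProjection_of_mem_orthogonal' (z := Q (x - L.starProjection x))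
    (hQ _ (L.starProjection_apply_mem x))
    (apply_mem_orthogonal hQ (L.sub_starProjection_mem_orthogonal x)) ?_
  rw [← map_add]
  simp

theorem reflection_orthogonal_singleton {E : Type*} [NormedAddCommGroup E]
    [InnerProductSpace ℝ E] (v x : E) :
    (ℝ ∙ v)ᗮ.reflection x = x - (2 * (inner ℝ v x / ‖v‖ ^ 2)) • v := by
  rw [Submodule.reflection_orthogonal_apply, Submodule.reflection_singleton_apply]
  simp only [RCLike.ofReal_real_eq_id, id]
  module

/-- The stabiliser of `L` in the orthogonal group is transitive on the points whose components in
`L` and `Lᗮ` have prescribed norms. -/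
theorem exists_isometry_preserving {L : Submodule ℝ E} {x y : E}
    (h : ‖L.starProjection x‖ = ‖L.starProjection y‖)
    (h' : ‖Lᗮ.starProjection x‖ = ‖Lᗮ.starProjection y‖) :
    ∃ Q : E ≃ₗᵢ[ℝ] E, (∀ z ∈ L, Q z ∈ L) ∧ Q x = y := by
  -- Reflecting in the hyperplane orthogonal to `v` exchanges the `L`-components and fixes `Lᗮ`; `w`
  -- does the same for the `Lᗮ`-components. The composite is the required isometry.
  set v := L.starProjection x - L.starProjection y
  set w := Lᗮ.starProjection x - Lᗮ.starProjection y
  have hv : v ∈ L := L.sub_mem (L.starProjection_apply_mem x) (L.starProjection_apply_mem y)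
  have hw : w ∈ Lᗮ := Lᗮ.sub_mem (Lᗮ.starProjection_apply_mem x) (Lᗮ.starProjection_apply_mem y)
  have fixw : ∀ z ∈ L, (ℝ ∙ w)ᗮ.reflection z = z := fun z hz => by
    rw [reflection_orthogonal_singleton, Submodule.inner_left_of_mem_orthogonal hz hw]
    simp
  have fixv : ∀ z ∈ Lᗮ, (ℝ ∙ v)ᗮ.reflection z = z := fun z hz => by
    rw [reflection_orthogonal_singleton, Submodule.inner_right_of_mem_orthogonal hv hz]
    simp
  refine ⟨(ℝ ∙ v)ᗮ.reflection.trans (ℝ ∙ w)ᗮ.reflection, fun z hz => ?_, ?_⟩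
  · have : (ℝ ∙ v)ᗮ.reflection z ∈ L := by
      rw [reflection_orthogonal_singleton]
      exact L.sub_mem hz (L.smul_mem _ hv)
    rw [LinearIsometryEquiv.trans_apply, fixw _ this]
    exact this
  · rw [LinearIsometryEquiv.trans_apply]
    conv_lhs => rw [← L.starProjection_add_starProjection_orthogonal x]
    rw [map_add, Submodule.reflection_sub h, fixv _ (Lᗮ.starProjection_apply_mem x), map_add,
      fixw _ (L.starProjection_apply_mem y), Submodule.reflection_sub h',
      L.starProjection_add_starProjection_orthogonal]

variable [MeasurableSpace E] [BorelSpace E]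

theorem charFun_add_measure (p q : Measure E) [IsFiniteMeasure p] [IsFiniteMeasure q] (ξ : E) :
    charFun (p + q) ξ = charFun p ξ + charFun q ξ := by
  have key : ∀ r : Measure E, IsFiniteMeasure r →
      Integrable (fun x => Complex.exp ((inner ℝ x ξ : ℝ) * Complex.I)) r := fun r _ => by
    refine Integrable.of_bound (C := 1) (Measurable.aestronglyMeasurable (by fun_prop)) ?_
    exact .of_forall fun x => by rw [Complex.norm_exp_ofReal_mul_I]
  simp only [charFun_apply]
  exact integral_add_measure (key p inferInstance) (key q inferInstance)

theorem charFun_smul_measure {E : Type*} [NormedAddCommGroup E] [InnerProductSpace ℝ E]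
    [MeasurableSpace E] (p : Measure E) (c : ENNReal) (ξ : E) :
    charFun (c • p) ξ = c.toReal * charFun p ξ := by
  simp only [charFun_apply]
  rw [integral_smul_measure, Complex.real_smul]

theorem charFun_map_isometry (p : Measure E) (Q : E ≃ₗᵢ[ℝ] E) (ξ : E) :
    charFun (p.map Q) (Q ξ) = charFun p ξ := by
  simp only [charFun_apply]
  rw [integral_map Q.continuous.measurable.aemeasurable
    (Measurable.aestronglyMeasurable (by fun_prop))]
  simp

/-- Fubini for the kernel `exp (i ⟪x, T u⟫)`, which is symmetric in the two variables up to moving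
the self-adjoint `T` across. -/
theorem integral_charFun_comp_eq {T : E →L[ℝ] E} (hT : ∀ x y, inner ℝ (T x) y = inner ℝ x (T y))
    (p σ : Measure E) [IsFiniteMeasure p] [IsFiniteMeasure σ] :
    ∫ u, charFun p (T u) ∂σ = ∫ x, charFun σ (T x) ∂p := by
  simp only [charFun_apply]
  rw [integral_integral_swap]
  · refine integral_congr_ae (.of_forall fun x => integral_congr_ae (.of_forall fun u => ?_))
    simp only
    rw [← hT, real_inner_comm]
  · refine Integrable.of_bound (C := 1) (Measurable.aestronglyMeasurable ?_) ?_
    · simp only [Function.uncurry_def]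
      fun_prop
    · exact .of_forall fun x => by
        rw [Function.uncurry_def, Complex.norm_exp_ofReal_mul_I]

theorem measurable_charFun_comp (p : Measure E) [IsFiniteMeasure p] (T : E →L[ℝ] E) :
    Measurable fun u => charFun p (T u) :=
  (measurable_charFun (μ := p)).comp T.measurable

/-- Uniqueness of invariant measures: a difference `p - q` of finite measures on the set of vectors
whose components in `L` and `Lᗮ` have norms `a` and `b`, invariant under the stabiliser of `L`, is a
multiple of any invariant probability measure. -/
theorem add_smul_eq_add_smul_of_invariant (L : Submodule ℝ E) (a b : ℝ)
    (ha : a = 1 ∨ L = ⊥) (hb : b = 1 ∨ Lᗮ = ⊥)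
    (p q σ : Measure E) [IsFiniteMeasure p] [IsFiniteMeasure q] [IsProbabilityMeasure σ]
    (hp : ∀ᵐ y ∂p, ‖L.starProjection y‖ = a ∧ ‖Lᗮ.starProjection y‖ = b)
    (hq : ∀ᵐ y ∂q, ‖L.starProjection y‖ = a ∧ ‖Lᗮ.starProjection y‖ = b)
    (hσ : ∀ᵐ y ∂σ, ‖L.starProjection y‖ = a ∧ ‖Lᗮ.starProjection y‖ = b)
    (inv : ∀ Q : E ≃ₗᵢ[ℝ] E, (∀ z ∈ L, Q z ∈ L) → p.map Q + q = p + q.map Q)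
    (invσ : ∀ Q : E ≃ₗᵢ[ℝ] E, (∀ z ∈ L, Q z ∈ L) → σ.map Q = σ) :
    p + q Set.univ • σ = q + p Set.univ • σ := by
  have key : ∀ ξ, charFun p ξ - charFun q ξ =
      (p Set.univ).toReal * charFun σ ξ - (q Set.univ).toReal * charFun σ ξ := by
    intro ξ
    -- `T` rescales the two components so that it carries every admissible vector into the orbit of
    -- `ξ` under the stabiliser of `L`.
    set T : E →L[ℝ] E := ‖L.starProjection ξ‖ • L.starProjection +
      ‖Lᗮ.starProjection ξ‖ • Lᗮ.starProjection with hTdef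
    have hT : ∀ x y, inner ℝ (T x) y = inner ℝ x (T y) := fun x y => by
      simp only [hTdef, add_apply, smul_apply,
        inner_add_left, inner_add_right, real_inner_smul_left, real_inner_smul_right,
        Submodule.inner_starProjection_left_eq_right]
    have hproj : ∀ y, L.starProjection (T y) = ‖L.starProjection ξ‖ • L.starProjection y ∧
        Lᗮ.starProjection (T y) = ‖Lᗮ.starProjection ξ‖ • Lᗮ.starProjection y := fun y => by
      constructor
      · refine Submodule.eq_starProjection_of_mem_orthogonal'
          (L.smul_mem _ (L.starProjection_apply_mem y))
          (Lᗮ.smul_mem _ (Lᗮ.starProjection_apply_mem y)) rfl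
      · refine Submodule.eq_starProjection_of_mem_orthogonal'
          (Lᗮ.smul_mem _ (Lᗮ.starProjection_apply_mem y))
          (L.le_orthogonal_orthogonal (L.smul_mem ‖L.starProjection ξ‖
            (L.starProjection_apply_mem y))) (add_comm _ _)
    have trans : ∀ y, ‖L.starProjection y‖ = a ∧ ‖Lᗮ.starProjection y‖ = b →
        ∃ Q : E ≃ₗᵢ[ℝ] E, (∀ z ∈ L, Q z ∈ L) ∧ Q ξ = T y := fun y hy => by
      refine exists_isometry_preserving ?_ ?_
      · rw [(hproj y).1, norm_smul, norm_norm, hy.1]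
        rcases ha with rfl | rfl <;> simp
      · rw [(hproj y).2, norm_smul, norm_norm, hy.2]
        rcases hb with rfl | hb
        · simp
        · simp [hb]
    -- By invariance the characteristic function of `p - q` is constant on orbits. Averaging this
    -- over `σ` and exchanging the integrals turns it into the total mass times that of `σ`.
    have e1 : ∀ u, ‖L.starProjection u‖ = a ∧ ‖Lᗮ.starProjection u‖ = b →
        charFun p (T u) - charFun q (T u) = charFun p ξ - charFun q ξ := fun u hu => by
      obtain ⟨Q, hQ, h⟩ := trans u hu
      have := congrArg (fun r => charFun r (Q ξ)) (inv Q hQ)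
      have f1 : IsFiniteMeasure (p.map Q) := inferInstance
      have f2 : IsFiniteMeasure (q.map Q) := inferInstance
      simp only [charFun_add_measure, charFun_map_isometry] at this
      rw [← h]
      linear_combination -this
    have e2 : ∀ x, ‖L.starProjection x‖ = a ∧ ‖Lᗮ.starProjection x‖ = b →
        charFun σ (T x) = charFun σ ξ := fun u hu => by
      obtain ⟨Q, hQ, h⟩ := trans u hu
      rw [← h, ← charFun_map_isometry σ Q ξ, invσ Q hQ]
    have int : ∀ r : Measure E, IsFiniteMeasure r →
        Integrable (fun u => charFun r (T u)) σ := fun r _ => by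
      refine Integrable.of_bound (C := r.real Set.univ)
        (measurable_charFun_comp r T).aestronglyMeasurable ?_
      exact .of_forall fun u => norm_charFun_le _
    have e3 : ∀ r : Measure E, IsFiniteMeasure r →
        (∀ᵐ y ∂r, ‖L.starProjection y‖ = a ∧ ‖Lᗮ.starProjection y‖ = b) →
        ∫ u, charFun r (T u) ∂σ = (r Set.univ).toReal * charFun σ ξ := fun r _ hr => by
      rw [integral_charFun_comp_eq hT, integral_congr_ae (hr.mono e2), integral_const,
        Complex.real_smul]
      rfl
    rw [← e3 p inferInstance hp, ← e3 q inferInstance hq, ← integral_sub (int p inferInstance)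
      (int q inferInstance), integral_congr_ae (hσ.mono e1)]
    simp
  have : IsFiniteMeasure (q Set.univ • σ) := Measure.smul_finite _ (measure_ne_top q _)
  have : IsFiniteMeasure (p Set.univ • σ) := Measure.smul_finite _ (measure_ne_top p _)
  refine Measure.ext_of_charFun (funext fun ξ => ?_)
  rw [charFun_add_measure, charFun_add_measure, charFun_smul_measure, charFun_smul_measure]
  linear_combination key ξ

end InvariantMeasures

/-! ### Gaussian null sets -/

section Gaussian

variable {E : Type*} [NormedAddCommGroup E] [InnerProductSpace ℝ E] [FiniteDimensional ℝ E]
  [MeasurableSpace E] [BorelSpace E]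

/-- Pairing with a nonzero vector orthogonal to `V` gives a nondegenerate real Gaussian, which has
no atom at zero. -/
theorem stdGaussian_submodule_eq_zero {V : Submodule ℝ E} (hV : V ≠ ⊤) :
    stdGaussian E (V : Set E) = 0 := by
  obtain ⟨v, hv, hv0⟩ : ∃ v ∈ Vᗮ, v ≠ 0 :=
    Submodule.exists_mem_ne_zero_of_ne_bot (by rwa [Ne, Submodule.orthogonal_eq_bot_iff])
  set f : StrongDual ℝ E := innerSL ℝ v
  have hmap := IsGaussian.map_eq_gaussianReal (μ := stdGaussian E) f
  rw [variance_dual_stdGaussian] at hmap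
  have hne : (‖f‖ ^ 2).toNNReal ≠ 0 := by
    rw [innerSL_apply_norm]
    simpa using hv0
  have : NullSingletonClass (gaussianReal (∫ x, f x ∂stdGaussian E) (‖f‖ ^ 2).toNNReal) :=
    nullSingletonClass_gaussianReal hne
  have h0 : (stdGaussian E).map f {0} = 0 := by
    rw [hmap, measure_singleton]
  rw [Measure.map_apply f.measurable (measurableSet_singleton _)] at h0
  exact measure_mono_null (fun x hx => Submodule.inner_left_of_mem_orthogonal hx hv) h0

theorem ae_starProjection_ne_zero {L : Submodule ℝ E} (hL : L ≠ ⊥) :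
    ∀ᵐ g ∂stdGaussian E, L.starProjection g ≠ 0 := by
  have h : Lᗮ ≠ ⊤ := by rwa [Ne, Submodule.orthogonal_eq_top_iff]
  refine measure_mono_null (fun g hg => ?_) (stdGaussian_submodule_eq_zero h)
  have hg0 : L.starProjection g = 0 := not_not.mp hg
  simpa [hg0] using L.sub_starProjection_mem_orthogonal g

end Gaussian

/-! ### Invariant signed measures -/

section SignedMeasure

variable {α : Type*} [MeasurableSpace α]

theorem exists_finite_measures_sub_eq (s : SignedMeasure α) :
    ∃ p q : Measure α, IsFiniteMeasure p ∧ IsFiniteMeasure q ∧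
      ∀ B, MeasurableSet B → s B = p.real B - q.real B := by
  refine ⟨s.toJordanDecomposition.posPart, s.toJordanDecomposition.negPart,
    inferInstance, inferInstance, fun B hB => ?_⟩
  conv_lhs => rw [← s.toSignedMeasure_toJordanDecomposition]
  rw [JordanDecomposition.toSignedMeasure, Measure.toSignedMeasure_sub_apply hB]

theorem signedMeasure_eq_inter_add_diff (s : SignedMeasure α) {A B : Set α} (hA : MeasurableSet A)
    (hB : MeasurableSet B) : s B = s (B ∩ A) + s (B \ A) := by
  rw [← VectorMeasure.of_add_of_sdiff (hB.inter hA) hB Set.inter_subset_left,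
    Set.sdiff_self_inter]

variable {E : Type*} [NormedAddCommGroup E] [InnerProductSpace ℝ E] [FiniteDimensional ℝ E]
  [MeasurableSpace E] [BorelSpace E]

theorem measurableSet_norm_starProjection_eq (L : Submodule ℝ E) (a b : ℝ) :
    MeasurableSet {y : E | ‖L.starProjection y‖ = a ∧ ‖Lᗮ.starProjection y‖ = b} :=
  (measurableSet_eq_fun (by fun_prop) (by fun_prop)).inter
    (measurableSet_eq_fun (by fun_prop) (by fun_prop))

/-- Transports the uniqueness statement along `T`, so that `s` may live on any σ-algebra for which
`T` is measurable; this is needed because the biconic σ-algebra is smaller than the Borel one. -/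
theorem signedMeasure_preimage_eq_mul (L : Submodule ℝ E) (a b : ℝ)
    (ha : a = 1 ∨ L = ⊥) (hb : b = 1 ∨ Lᗮ = ⊥) (s : SignedMeasure α) {G : Set α}
    (hG : MeasurableSet G) {T : α → E} (hT : Measurable T)
    (hGT : ∀ x ∈ G, ‖L.starProjection (T x)‖ = a ∧ ‖Lᗮ.starProjection (T x)‖ = b)
    (inv : ∀ Q : E ≃ₗᵢ[ℝ] E, (∀ z ∈ L, Q z ∈ L) → ∀ B, MeasurableSet B →
      s (T ⁻¹' (Q ⁻¹' B) ∩ G) = s (T ⁻¹' B ∩ G))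
    (σ : Measure E) [IsProbabilityMeasure σ]
    (hσ : ∀ᵐ y ∂σ, ‖L.starProjection y‖ = a ∧ ‖Lᗮ.starProjection y‖ = b)
    (invσ : ∀ Q : E ≃ₗᵢ[ℝ] E, (∀ z ∈ L, Q z ∈ L) → σ.map Q = σ)
    {B : Set E} (hB : MeasurableSet B) : s (T ⁻¹' B ∩ G) = s G * σ.real B := by
  obtain ⟨p, q, hp, hq, hs⟩ := exists_finite_measures_sub_eq s
  have happ : ∀ (r : Measure α) (A : Set E), MeasurableSet A →
      ((r.restrict G).map T).real A = r.real (T ⁻¹' A ∩ G) := fun r A hA => by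
    rw [measureReal_def, Measure.map_apply hT hA, Measure.restrict_apply (hT hA)]
    rfl
  have hsub : ∀ A : Set E, MeasurableSet A → s (T ⁻¹' A ∩ G) =
      ((p.restrict G).map T).real A - ((q.restrict G).map T).real A := fun A hA => by
    rw [happ p A hA, happ q A hA, hs _ ((hT hA).inter hG)]
  have hae : ∀ r : Measure α, ∀ᵐ y ∂((r.restrict G).map T),
      ‖L.starProjection y‖ = a ∧ ‖Lᗮ.starProjection y‖ = b := fun r => by
    rw [ae_map_iff hT.aemeasurable (measurableSet_norm_starProjection_eq L a b), ae_restrict_iff' hG]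
    exact .of_forall hGT
  have hpf : IsFiniteMeasure ((p.restrict G).map T) := inferInstance
  have hqf : IsFiniteMeasure ((q.restrict G).map T) := inferInstance
  have hs1 := hsub Set.univ MeasurableSet.univ
  rw [Set.preimage_univ, Set.univ_inter] at hs1
  rw [hsub B hB, hs1]
  have hap := hae p
  have haq := hae q
  generalize (p.restrict G).map T = p' at *
  generalize (q.restrict G).map T = q' at *
  -- Only the difference of the two pushed-forward measures is known to be invariant, hence the
  -- additive form.
  have hinv : ∀ Q : E ≃ₗᵢ[ℝ] E, (∀ z ∈ L, Q z ∈ L) → p'.map Q + q' = p' + q'.map Q := by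
    intro Q hQ
    ext A hA
    have hQA : MeasurableSet (Q ⁻¹' A) := Q.continuous.measurable hA
    have h := inv Q hQ A hA
    rw [hsub A hA, hsub _ hQA] at h
    rw [Measure.add_apply, Measure.add_apply, Measure.map_apply Q.continuous.measurable hA,
      Measure.map_apply Q.continuous.measurable hA, ← ENNReal.toReal_eq_toReal_iff'
        (by finiteness) (by finiteness), ENNReal.toReal_add (by finiteness) (by finiteness),
      ENNReal.toReal_add (by finiteness) (by finiteness)]
    simp only [measureReal_def] at h
    linarith
  have key := congrArg (fun m => (m B).toReal)
    (add_smul_eq_add_smul_of_invariant L a b ha hb p' q' σ hap haq hσ hinv invσ)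
  simp only [Measure.add_apply, Measure.smul_apply, smul_eq_mul] at key
  rw [ENNReal.toReal_add (by finiteness) (by finiteness),
    ENNReal.toReal_add (by finiteness) (by finiteness), ENNReal.toReal_mul,
    ENNReal.toReal_mul] at key
  simp only [measureReal_def]
  linarith

end SignedMeasure

/-! ### Biconic sets and generic pairs -/

section Biconic

variable {d : ℕ}

theorem IsBiconic.smul_mem_iff {M : Set (Euc d × Euc d)} (hM : IsBiconic M) {s t : ℝ} (hs : 0 < s)
    (ht : 0 < t) (x z : Euc d) : (s • x, t • z) ∈ M ↔ (x, z) ∈ M := by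
  conv_lhs => rw [← hM.2 s t hs ht]
  exact (biscale_bijective hs ht).1.mem_set_image (a := (x, z))

theorem isBiconic_of_forall_smul_mem {M : Set (Euc d × Euc d)} (hM : MeasurableSet M)
    (h : ∀ s t : ℝ, 0 < s → 0 < t → ∀ x z, (x, z) ∈ M → (s • x, t • z) ∈ M) : IsBiconic M := by
  refine ⟨hM, fun s t hs ht => Set.Subset.antisymm ?_ fun p hp => ?_⟩
  · rintro _ ⟨p, hp, rfl⟩
    exact h s t hs ht _ _ hp
  · refine ⟨(s⁻¹ • p.1, t⁻¹ • p.2), h _ _ (inv_pos.2 hs) (inv_pos.2 ht) _ _ hp, ?_⟩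
    simp [smul_smul, hs.ne', ht.ne']

theorem IsBiconic.inter {M N : Set (Euc d × Euc d)} (hM : IsBiconic M) (hN : IsBiconic N) :
    IsBiconic (M ∩ N) :=
  @MeasurableSet.inter _ (biconicAlgebra d) _ _ hM hN

theorem IsBiconic.diff {M N : Set (Euc d × Euc d)} (hM : IsBiconic M) (hN : IsBiconic N) :
    IsBiconic (M \ N) :=
  @MeasurableSet.diff _ (biconicAlgebra d) _ _ hM hN

theorem IsBiconic.compl {M : Set (Euc d × Euc d)} (hM : IsBiconic M) : IsBiconic Mᶜ :=
  @MeasurableSet.compl _ _ (biconicAlgebra d) hM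

theorem isBiconic_zero : IsBiconic ({0} : Set (Euc d × Euc d)) := by
  refine isBiconic_of_forall_smul_mem (measurableSet_singleton _) fun s t _ _ x z h => ?_
  obtain ⟨rfl, rfl⟩ := Prod.mk.inj h
  simp

theorem IsBiconic.biRotate {M : Set (Euc d × Euc d)} (hM : IsBiconic M)
    (Q : Euc d ≃ₗᵢ[ℝ] Euc d) : IsBiconic (biRotate Q M) := by
  refine isBiconic_of_forall_smul_mem ?_ ?_
  · have : _root_.biRotate Q M = (fun p : Euc d × Euc d => (Q.symm p.1, Q.symm p.2)) ⁻¹' M := by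
      ext p
      constructor
      · rintro ⟨q, hq, rfl⟩
        simpa using hq
      · intro hp
        exact ⟨_, hp, by simp⟩
    rw [this]
    have hm : Measurable fun p : Euc d × Euc d => (Q.symm p.1, Q.symm p.2) := by fun_prop
    exact hm hM.1
  · rintro s t hs ht x z ⟨p, hp, h⟩
    obtain ⟨rfl, rfl⟩ := Prod.mk.inj h
    exact ⟨(s • p.1, t • p.2), (hM.smul_mem_iff hs ht _ _).2 hp, by simp⟩

/-- The sum of the two components after normalisation to unit length (or zero). -/
noncomputable def unitSum (p : Euc d × Euc d) : Euc d := ‖p.1‖⁻¹ • p.1 + ‖p.2‖⁻¹ • p.2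

theorem inv_norm_smul_smul {s : ℝ} (hs : 0 < s) (x : Euc d) :
    ‖s • x‖⁻¹ • s • x = ‖x‖⁻¹ • x := by
  rw [norm_smul, Real.norm_of_nonneg hs.le, smul_smul, mul_inv, mul_assoc, mul_comm ‖x‖⁻¹,
    inv_mul_cancel_left₀ hs.ne']

theorem measurable_unitSum : Measurable (unitSum : Euc d × Euc d → Euc d) := by
  unfold unitSum
  fun_prop

/-- Normalising removes both scalings, so `unitSum` is measurable from the biconic σ-algebra to the
Borel one. -/
theorem isBiconic_unitSum_preimage {B : Set (Euc d)} (hB : MeasurableSet B) :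
    IsBiconic (unitSum ⁻¹' B) := by
  refine isBiconic_of_forall_smul_mem (measurable_unitSum hB) fun s t hs ht x z h => ?_
  simpa only [Set.mem_preimage, unitSum, inv_norm_smul_smul hs, inv_norm_smul_smul ht] using h

theorem IsBiconic.normalize_mem_iff {M : Set (Euc d × Euc d)} (hM : IsBiconic M) (x z : Euc d) :
    (‖x‖⁻¹ • x, ‖z‖⁻¹ • z) ∈ M ↔ (x, z) ∈ M := by
  have key : ∀ x : Euc d, ∃ s : ℝ, 0 < s ∧ ‖x‖⁻¹ • x = s • x := fun x => by
    rcases eq_or_ne x 0 with rfl | hx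
    · exact ⟨1, one_pos, by simp⟩
    · exact ⟨_, inv_pos.2 (norm_pos_iff.2 hx), rfl⟩
  obtain ⟨s, hs, h⟩ := key x
  obtain ⟨t, ht, h'⟩ := key z
  rw [h, h', hM.smul_mem_iff hs ht]

theorem norm_inv_norm_smul {x : Euc d} (hx : x ≠ 0) : ‖‖x‖⁻¹ • x‖ = 1 := by
  rw [norm_smul, norm_inv, norm_norm, inv_mul_cancel₀ (norm_ne_zero_iff.2 hx)]

theorem unitSum_biRotate (Q : Euc d ≃ₗᵢ[ℝ] Euc d) (x z : Euc d) :
    unitSum (Q x, Q z) = Q (unitSum (x, z)) := by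
  simp [unitSum]

/-- The components of a vector in a subspace and in its orthogonal complement. -/
noncomputable def orthogonalSplit (L : Submodule ℝ (Euc d)) (g : Euc d) : Euc d × Euc d :=
  (L.starProjection g, Lᗮ.starProjection g)

theorem measurable_orthogonalSplit (L : Submodule ℝ (Euc d)) : Measurable (orthogonalSplit L) := by
  unfold orthogonalSplit
  fun_prop

theorem orthogonalSplit_add {L : Submodule ℝ (Euc d)} {x z : Euc d} (hx : x ∈ L) (hz : z ∈ Lᗮ) :
    orthogonalSplit L (x + z) = (x, z) :=
  Prod.ext (Submodule.eq_starProjection_of_mem_orthogonal' hx hz rfl)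
    (Submodule.eq_starProjection_of_mem_orthogonal' hz (L.le_orthogonal_orthogonal hx)
      (add_comm _ _))

theorem orthogonalSplit_unitSum {L : Submodule ℝ (Euc d)} {x z : Euc d} (hx : x ∈ L)
    (hz : z ∈ Lᗮ) : orthogonalSplit L (unitSum (x, z)) = (‖x‖⁻¹ • x, ‖z‖⁻¹ • z) :=
  orthogonalSplit_add (L.smul_mem _ hx) (Lᗮ.smul_mem _ hz)

/-- The pairs in `L × Lᗮ` neither of whose components vanishes, unless it has to. -/
def genericPairs (L : Submodule ℝ (Euc d)) : Set (Euc d × Euc d) :=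
  {p | p.1 ∈ L ∧ p.2 ∈ Lᗮ ∧ (L ≠ ⊥ → p.1 ≠ 0) ∧ (Lᗮ ≠ ⊥ → p.2 ≠ 0)}

theorem measurableSet_submodule (L : Submodule ℝ (Euc d)) : MeasurableSet (L : Set (Euc d)) :=
  L.closed_of_finiteDimensional.measurableSet

theorem isBiconic_genericPairs (L : Submodule ℝ (Euc d)) : IsBiconic (genericPairs L) := by
  refine isBiconic_of_forall_smul_mem ?_ fun s t hs ht x z h =>
    ⟨L.smul_mem _ h.1, Lᗮ.smul_mem _ h.2.1, fun hL => smul_ne_zero hs.ne' (h.2.2.1 hL),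
      fun hL => smul_ne_zero ht.ne' (h.2.2.2 hL)⟩
  refine (measurable_fst (measurableSet_submodule L)).inter
    ((measurable_snd (measurableSet_submodule Lᗮ)).inter (.inter ?_ ?_))
  · exact MeasurableSet.imp (.const _) (measurable_fst (measurableSet_singleton 0).compl)
  · exact MeasurableSet.imp (.const _) (measurable_snd (measurableSet_singleton 0).compl)

theorem ae_orthogonalSplit_mem_genericPairs (L : Submodule ℝ (Euc d)) :
    ∀ᵐ g ∂stdGaussian (Euc d), orthogonalSplit L g ∈ genericPairs L := by
  have h1 : ∀ᵐ g ∂stdGaussian (Euc d), L ≠ ⊥ → L.starProjection g ≠ 0 := by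
    rw [Filter.eventually_imp_distrib_left]
    exact ae_starProjection_ne_zero
  have h2 : ∀ᵐ g ∂stdGaussian (Euc d), Lᗮ ≠ ⊥ → Lᗮ.starProjection g ≠ 0 := by
    rw [Filter.eventually_imp_distrib_left]
    exact ae_starProjection_ne_zero
  filter_upwards [h1, h2] with g hg1 hg2
  exact ⟨L.starProjection_apply_mem g, Lᗮ.starProjection_apply_mem g, hg1, hg2⟩

theorem orthogonalSplit_apply {L : Submodule ℝ (Euc d)} {Q : Euc d ≃ₗᵢ[ℝ] Euc d}
    (hQ : ∀ x ∈ L, Q x ∈ L) (g : Euc d) :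
    orthogonalSplit L (Q g) = (Q (L.starProjection g), Q (Lᗮ.starProjection g)) :=
  Prod.ext (starProjection_apply_comm hQ g)
    (starProjection_apply_comm (fun _ hx => apply_mem_orthogonal hQ hx) g)

theorem biRotate_genericPairs {L : Submodule ℝ (Euc d)} {Q : Euc d ≃ₗᵢ[ℝ] Euc d}
    (hQ : ∀ x ∈ L, Q x ∈ L) {x z : Euc d} (h : (x, z) ∈ genericPairs L) :
    (Q x, Q z) ∈ genericPairs L :=
  ⟨hQ _ h.1, apply_mem_orthogonal hQ h.2.1, fun hL => by simpa using h.2.2.1 hL,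
    fun hL => by simpa using h.2.2.2 hL⟩

/-- A biconic measure invariant under the stabiliser of `L` is, on generic pairs of `L × Lᗮ`, a
multiple of the law of the components of a Gaussian vector. -/
theorem BiconicMeasure.eq_mul_of_subset_genericPairs (L : Submodule ℝ (Euc d))
    (s : BiconicMeasure d)
    (inv : ∀ Q : Euc d ≃ₗᵢ[ℝ] Euc d, (∀ z ∈ L, Q z ∈ L) → ∀ M, IsBiconic M →
      s (biRotate Q M) = s M)
    {M : Set (Euc d × Euc d)} (hM : IsBiconic M) (hML : M ⊆ genericPairs L) :
    s M = s (genericPairs L) * (stdGaussian (Euc d)).real {g | orthogonalSplit L g ∈ M} := by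
  classical
  have hσm : Measurable fun g => unitSum (orthogonalSplit L g) :=
    measurable_unitSum.comp (measurable_orthogonalSplit L)
  -- The component in a trivial subspace has norm 0; on generic pairs the others have norm 1.
  have hU : ∀ p ∈ genericPairs L,
      ‖L.starProjection (unitSum p)‖ = (if L = ⊥ then 0 else 1) ∧
      ‖Lᗮ.starProjection (unitSum p)‖ = if Lᗮ = ⊥ then 0 else 1 := by
    rintro ⟨x, z⟩ ⟨hx, hz, hx0, hz0⟩
    have h := orthogonalSplit_unitSum hx hz
    have h1 : L.starProjection (unitSum (x, z)) = ‖x‖⁻¹ • x := congrArg Prod.fst h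
    have h2 : Lᗮ.starProjection (unitSum (x, z)) = ‖z‖⁻¹ • z := congrArg Prod.snd h
    rw [h1, h2]
    constructor
    · split_ifs with hL
      · rw [hL] at hx
        simpa using hx
      · exact norm_inv_norm_smul (hx0 hL)
    · split_ifs with hL
      · rw [hL] at hz
        simpa using hz
      · exact norm_inv_norm_smul (hz0 hL)
  have hB : MeasurableSet {y | orthogonalSplit L y ∈ M} := measurable_orthogonalSplit L hM.1
  -- On `L × Lᗮ` the split of `unitSum` recovers the normalised pair, and a biconic set cannot tell
  -- it from the original pair.
  have hMB : unitSum ⁻¹' {y | orthogonalSplit L y ∈ M} ∩ genericPairs L = M := by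
    ext ⟨x, z⟩
    constructor
    · rintro ⟨h, hg⟩
      rw [Set.mem_preimage, Set.mem_ofPred_eq, orthogonalSplit_unitSum hg.1 hg.2.1,
        hM.normalize_mem_iff] at h
      exact h
    · intro h
      have hg := hML h
      refine ⟨?_, hg⟩
      rw [Set.mem_preimage, Set.mem_ofPred_eq, orthogonalSplit_unitSum hg.1 hg.2.1,
        hM.normalize_mem_iff]
      exact h
  have : IsProbabilityMeasure
      ((stdGaussian (Euc d)).map fun g => unitSum (orthogonalSplit L g)) :=
    Measure.isProbabilityMeasure_map hσm.aemeasurable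
  have key := @signedMeasure_preimage_eq_mul _ (biconicAlgebra d) (Euc d) _ _ _ _ _ L
    (if L = ⊥ then 0 else 1) (if Lᗮ = ⊥ then 0 else 1) (by split_ifs <;> simp [*])
    (by split_ifs <;> simp [*]) s (genericPairs L) (isBiconic_genericPairs L) unitSum
    (fun _ hA => isBiconic_unitSum_preimage hA) hU ?_
    ((stdGaussian (Euc d)).map fun g => unitSum (orthogonalSplit L g)) _ ?_ ?_ _ hB
  · rw [hMB] at key
    rw [key, measureReal_def, measureReal_def, Measure.map_apply hσm hB]
    congr 3
    ext g
    have h := orthogonalSplit_unitSum (L.starProjection_apply_mem g)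
      (Lᗮ.starProjection_apply_mem g)
    change orthogonalSplit L (unitSum (L.starProjection g, Lᗮ.starProjection g)) ∈ M ↔ _
    rw [h, hM.normalize_mem_iff]
    rfl
  · intro Q hQ A hA
    rw [← inv Q hQ _ ((isBiconic_unitSum_preimage (Q.continuous.measurable hA)).inter
      (isBiconic_genericPairs L))]
    congr 1
    ext ⟨x, z⟩
    constructor
    · rintro ⟨⟨x', z'⟩, ⟨h, hg⟩, h'⟩
      obtain ⟨rfl, rfl⟩ := Prod.mk.inj h'
      refine ⟨?_, biRotate_genericPairs hQ hg⟩
      rw [Set.mem_preimage, unitSum_biRotate]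
      exact h
    · rintro ⟨h, hg⟩
      refine ⟨(Q.symm x, Q.symm z), ⟨?_, biRotate_genericPairs
        (fun _ hx => symm_apply_mem hQ hx) hg⟩, by simp⟩
      rw [Set.mem_preimage, Set.mem_preimage, ← unitSum_biRotate]
      simpa using h
  · rw [ae_map_iff hσm.aemeasurable (measurableSet_norm_starProjection_eq L _ _)]
    filter_upwards [ae_orthogonalSplit_mem_genericPairs L] with g hg using hU _ hg
  · intro Q hQ
    have hQm : Measurable Q := Q.continuous.measurable
    rw [Measure.map_map hQm hσm]
    conv_rhs => rw [← stdGaussian_map Q, Measure.map_map hσm hQm]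
    congr 1
    ext1 g
    simp only [Function.comp_apply]
    rw [orthogonalSplit_apply hQ, unitSum_biRotate]
    rfl

end Biconic

/-! ### The measures attached to linear subspaces -/

section Subspaces

variable {d : ℕ}

/-- The assumptions of the characterization theorem: concentration on the biconic lift, rotation
invariance and locality. -/
structure IsLocalInvariant (ψ : PolyCone d → BiconicMeasure d) : Prop where
  concentrated : ∀ (C : PolyCone d) (M : Set (Euc d × Euc d)), IsBiconic M →
    ψ C M = ψ C (M ∩ biconicLift C)
  invariant : ∀ (Q : Euc d ≃ₗᵢ[ℝ] Euc d) (C : PolyCone d) (M : Set (Euc d × Euc d)),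
    IsBiconic M → ψ (C.map Q) (biRotate Q M) = ψ C M
  local_on_lift : ∀ (C D : PolyCone d) (M : Set (Euc d × Euc d)), IsBiconic M →
    biconicLift C ∩ M = biconicLift D ∩ M → ψ C M = ψ D M

theorem mem_biconicLift_ofSubspace {L : Submodule ℝ (Euc d)} {x z : Euc d} :
    (x, z) ∈ biconicLift (PolyCone.ofSubspace L) ↔ x ∈ L ∧ z ∈ Lᗮ := by
  constructor
  · rintro ⟨hx, hz, -⟩
    refine ⟨hx, (Submodule.mem_orthogonal _ _).2 fun u hu => le_antisymm (hz u hu) ?_⟩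
    have := hz (-u) (L.neg_mem hu)
    rw [inner_neg_left] at this
    linarith
  · rintro ⟨hx, hz⟩
    exact ⟨hx, fun u hu => (Submodule.inner_right_of_mem_orthogonal hu hz).le,
      Submodule.inner_right_of_mem_orthogonal hx hz⟩

theorem genericPairs_subset_biconicLift (L : Submodule ℝ (Euc d)) :
    genericPairs L ⊆ biconicLift (PolyCone.ofSubspace L) :=
  fun _ h => mem_biconicLift_ofSubspace.2 ⟨h.1, h.2.1⟩

theorem PolyCone.map_ofSubspace (Q : Euc d ≃ₗᵢ[ℝ] Euc d) (L : Submodule ℝ (Euc d)) :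
    (PolyCone.ofSubspace L).map Q =
      PolyCone.ofSubspace (L.map (Q.toLinearEquiv : Euc d →ₗ[ℝ] Euc d)) :=
  Subtype.ext rfl

/-- Matching orthonormal bases gives an isometry from `L` to `L'`, which extends to the whole space.
-/
theorem exists_isometry_map_eq {L L' : Submodule ℝ (Euc d)}
    (h : Module.finrank ℝ L = Module.finrank ℝ L') :
    ∃ Q : Euc d ≃ₗᵢ[ℝ] Euc d, L.map (Q.toLinearEquiv : Euc d →ₗ[ℝ] Euc d) = L' := by
  set e : L ≃ₗᵢ[ℝ] L' := 
    (stdOrthonormalBasis ℝ L).equiv (stdOrthonormalBasis ℝ L') (finCongr h)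
  set f : Euc d →ₗᵢ[ℝ] Euc d := (L'.subtypeₗᵢ.comp e.toLinearIsometry).extend
  refine ⟨f.toLinearIsometryEquiv rfl, ?_⟩
  have hf : ∀ x (hx : x ∈ L), f x = e ⟨x, hx⟩ := fun x hx =>
    LinearIsometry.extend_apply (L'.subtypeₗᵢ.comp e.toLinearIsometry) ⟨x, hx⟩
  refine Submodule.eq_of_le_of_finrank_eq ?_ ?_
  · rintro _ ⟨x, hx, rfl⟩
    change f x ∈ L'
    rw [hf x hx]
    exact (e ⟨x, hx⟩).2
  · rw [LinearEquiv.finrank_map_eq, h]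

theorem exists_submodule_finrank_eq {k : ℕ} (hk : k ≤ d) :
    ∃ L : Submodule ℝ (Euc d), Module.finrank ℝ L = k := by
  obtain ⟨f, hf⟩ := exists_linearIndependent_of_le_finrank (R := ℝ) (M := Euc d) (n := k)
    (by simpa)
  exact ⟨Submodule.span ℝ (Set.range f), by simpa using finrank_span_eq_card hf⟩

namespace IsLocalInvariant

variable {ψ : PolyCone d → BiconicMeasure d}

theorem congr (hψ : IsLocalInvariant ψ) {C D : PolyCone d} {M : Set (Euc d × Euc d)}
    (hM : IsBiconic M) (hC : M ⊆ biconicLift C) (hD : M ⊆ biconicLift D) : ψ C M = ψ D M :=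
  hψ.local_on_lift C D M hM <| by
    rw [Set.inter_eq_right.2 hC, Set.inter_eq_right.2 hD]

theorem subspace_generic (hψ : IsLocalInvariant ψ) (L : Submodule ℝ (Euc d))
    {M : Set (Euc d × Euc d)} (hM : IsBiconic M) (hML : M ⊆ genericPairs L) :
    ψ (PolyCone.ofSubspace L) M = ψ (PolyCone.ofSubspace L) (genericPairs L) *
      (stdGaussian (Euc d)).real {g | orthogonalSplit L g ∈ M} := by
  refine BiconicMeasure.eq_mul_of_subset_genericPairs L _ (fun Q hQ N hN => ?_) hM hML
  have h := hψ.invariant Q (PolyCone.ofSubspace L) N hN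
  rwa [PolyCone.map_ofSubspace, map_eq_of_forall_mem hQ] at h

theorem compl_zero_of_finrank_eq (hψ : IsLocalInvariant ψ) {L L' : Submodule ℝ (Euc d)}
    (h : Module.finrank ℝ L = Module.finrank ℝ L') :
    ψ (PolyCone.ofSubspace L) {0}ᶜ = ψ (PolyCone.ofSubspace L') {0}ᶜ := by
  obtain ⟨Q, rfl⟩ := exists_isometry_map_eq h
  rw [← PolyCone.map_ofSubspace, ← hψ.invariant Q _ _ isBiconic_zero.compl]
  congr 1
  ext ⟨x, z⟩
  constructor
  · rintro ⟨⟨x', z'⟩, hne, h'⟩ h0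
    have h1 := h'.trans h0
    exact hne (by simpa using h1)
  · intro hne
    refine ⟨(Q.symm x, Q.symm z), fun h0 => hne ?_, by simp⟩
    simpa using h0

/-- Such pairs also lie in the lift of `{0}`, where they are generic. The corresponding Gaussian
event is contained in `Lᗮ`, a proper subspace. -/
theorem subspace_fst_eq_zero (hψ : IsLocalInvariant ψ) {L : Submodule ℝ (Euc d)}
    (hL : L ≠ ⊥) {M : Set (Euc d × Euc d)} (hM : IsBiconic M)
    (hML : ∀ x z, (x, z) ∈ M → x = 0 ∧ z ∈ Lᗮ ∧ z ≠ 0) :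
    ψ (PolyCone.ofSubspace L) M = 0 := by
  rw [hψ.congr (D := PolyCone.ofSubspace ⊥) hM
    (fun p hp => mem_biconicLift_ofSubspace.2
      ⟨by rw [(hML _ _ hp).1]; exact L.zero_mem, (hML _ _ hp).2.1⟩)
    (fun p hp => mem_biconicLift_ofSubspace.2 ⟨(hML _ _ hp).1, by simp⟩),
    hψ.subspace_generic ⊥ hM fun p hp => ⟨(hML _ _ hp).1, by simp, fun h => (h rfl).elim,
      fun _ => (hML _ _ hp).2.2⟩, measureReal_def, measure_mono_null (t := (Lᗮ : Set (Euc d)))]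
  · simp
  · intro g hg
    simpa [orthogonalSplit, Submodule.starProjection_top] using (hML _ _ hg).2.1
  · exact stdGaussian_submodule_eq_zero (by rwa [Ne, Submodule.orthogonal_eq_top_iff])

/-- Dual argument: compare with the whole space, where the Gaussian event is contained in `L`. -/
theorem subspace_snd_eq_zero (hψ : IsLocalInvariant ψ) {L : Submodule ℝ (Euc d)}
    (hL : L ≠ ⊤) {M : Set (Euc d × Euc d)} (hM : IsBiconic M)
    (hML : ∀ x z, (x, z) ∈ M → x ∈ L ∧ x ≠ 0 ∧ z = 0) :
    ψ (PolyCone.ofSubspace L) M = 0 := by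
  rw [hψ.congr (D := PolyCone.ofSubspace ⊤) hM
    (fun p hp => mem_biconicLift_ofSubspace.2
      ⟨(hML _ _ hp).1, by rw [(hML _ _ hp).2.2]; exact Lᗮ.zero_mem⟩)
    (fun p hp => mem_biconicLift_ofSubspace.2
      ⟨trivial, by rw [(hML _ _ hp).2.2]; exact Submodule.zero_mem _⟩),
    hψ.subspace_generic ⊤ hM fun p hp => ⟨trivial,
      by rw [(hML _ _ hp).2.2]; exact Submodule.zero_mem _, fun _ => (hML _ _ hp).2.1,
      fun h => (h Submodule.top_orthogonal_eq_bot).elim⟩,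
    measureReal_def, measure_mono_null (t := (L : Set (Euc d)))]
  · simp
  · intro g hg
    simpa [orthogonalSplit, Submodule.starProjection_top] using (hML _ _ hg).1
  · exact stdGaussian_submodule_eq_zero hL

/-- A nonzero pair of the lift that is not generic has exactly one zero component, so splitting by
`p.1 = 0` leaves the two degenerate cases. -/
theorem subspace_disjoint_generic (hψ : IsLocalInvariant ψ) (L : Submodule ℝ (Euc d))
    {M : Set (Euc d × Euc d)} (hM : IsBiconic M)
    (hML : M ⊆ biconicLift (PolyCone.ofSubspace L)) (h0 : 0 ∉ M)
    (hgen : ∀ p ∈ M, p ∉ genericPairs L) :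
    ψ (PolyCone.ofSubspace L) M = 0 := by
  have hA : IsBiconic {p : Euc d × Euc d | p.1 = 0} :=
    isBiconic_of_forall_smul_mem (measurable_fst (measurableSet_singleton 0))
      fun s t _ _ x z h => by
        have hx : x = 0 := h
        simp [hx]
  rw [@signedMeasure_eq_inter_add_diff _ (biconicAlgebra d) (ψ (PolyCone.ofSubspace L)) _ _ hA hM]
  have h1 : ψ (PolyCone.ofSubspace L) (M ∩ {p | p.1 = 0}) = 0 := by
    by_cases hL : L = ⊥
    · convert VectorMeasure.empty _
      rw [Set.eq_empty_iff_forall_notMem]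
      rintro ⟨x, z⟩ ⟨hp, hx : x = 0⟩
      have hz := (mem_biconicLift_ofSubspace.1 (hML hp)).2
      refine hgen _ hp ⟨by simp [hx], hz, fun h => (h hL).elim, fun _ (hz0 : z = 0) => h0 ?_⟩
      rwa [hx, hz0] at hp
    · refine hψ.subspace_fst_eq_zero hL (hM.inter hA) ?_
      rintro x z ⟨hp, hx : x = 0⟩
      refine ⟨hx, (mem_biconicLift_ofSubspace.1 (hML hp)).2, fun hz0 => h0 ?_⟩
      rwa [hx, hz0] at hp
  have h2 : ψ (PolyCone.ofSubspace L) (M \ {p | p.1 = 0}) = 0 := by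
    by_cases hL : L = ⊤
    · convert VectorMeasure.empty _
      rw [Set.eq_empty_iff_forall_notMem]
      rintro ⟨x, z⟩ ⟨hp, hx : x ≠ 0⟩
      exact hgen _ hp ⟨(mem_biconicLift_ofSubspace.1 (hML hp)).1,
        (mem_biconicLift_ofSubspace.1 (hML hp)).2, fun _ => hx, fun h => (h (by simp [hL])).elim⟩
    · refine hψ.subspace_snd_eq_zero hL (hM.diff hA) ?_
      rintro x z ⟨hp, hx : x ≠ 0⟩
      refine ⟨(mem_biconicLift_ofSubspace.1 (hML hp)).1, hx, by_contra fun hz => hgen _ hp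
        ⟨(mem_biconicLift_ofSubspace.1 (hML hp)).1, (mem_biconicLift_ofSubspace.1 (hML hp)).2,
          fun _ => hx, fun _ => hz⟩⟩
  rw [h1, h2, add_zero]

theorem subspace_eq_inter_genericPairs (hψ : IsLocalInvariant ψ) (L : Submodule ℝ (Euc d))
    {M : Set (Euc d × Euc d)} (hM : IsBiconic M)
    (hML : M ⊆ biconicLift (PolyCone.ofSubspace L)) (h0 : 0 ∉ M) :
    ψ (PolyCone.ofSubspace L) M = ψ (PolyCone.ofSubspace L) (M ∩ genericPairs L) := by
  rw [@signedMeasure_eq_inter_add_diff _ (biconicAlgebra d) (ψ (PolyCone.ofSubspace L)) _ _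
    (isBiconic_genericPairs L) hM, hψ.subspace_disjoint_generic L
    (hM.diff (isBiconic_genericPairs L)) (Set.sdiff_subset.trans hML) (fun h => h0 h.1)
    fun p hp => hp.2, add_zero]

theorem subspace_eq_mul (hψ : IsLocalInvariant ψ) [NeZero d] (L : Submodule ℝ (Euc d))
    {M : Set (Euc d × Euc d)} (hM : IsBiconic M)
    (hML : M ⊆ biconicLift (PolyCone.ofSubspace L)) (h0 : 0 ∉ M) :
    ψ (PolyCone.ofSubspace L) M = ψ (PolyCone.ofSubspace L) {0}ᶜ *
      (stdGaussian (Euc d)).real {g | orthogonalSplit L g ∈ M} := by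
  -- Here `d > 0` matters: `L` and `Lᗮ` are not both trivial.
  have hgen : genericPairs L ⊆ {0}ᶜ := by
    rintro _ ⟨-, -, h1, h2⟩ rfl
    have hL : L = ⊥ := by_contra fun h => h1 h rfl
    have hL' : Lᗮ = ⊥ := by_contra fun h => h2 h rfl
    rw [Submodule.orthogonal_eq_bot_iff, hL] at hL'
    exact bot_ne_top hL'
  have hlift : IsBiconic (biconicLift (PolyCone.ofSubspace L)) := by
    refine isBiconic_of_forall_smul_mem ?_ fun s t _ _ x z h => ?_
    · convert (measurable_fst (measurableSet_submodule L)).inter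
        (measurable_snd (measurableSet_submodule Lᗮ)) using 1
      ext p
      exact mem_biconicLift_ofSubspace
    · rw [mem_biconicLift_ofSubspace] at h ⊢
      exact ⟨L.smul_mem _ h.1, Lᗮ.smul_mem _ h.2⟩
  have hc : ψ (PolyCone.ofSubspace L) {0}ᶜ = ψ (PolyCone.ofSubspace L) (genericPairs L) := by
    rw [hψ.concentrated _ _ isBiconic_zero.compl, hψ.subspace_eq_inter_genericPairs L
      (isBiconic_zero.compl.inter hlift) Set.inter_subset_right fun h => h.1 rfl]
    congr 1
    exact Set.inter_eq_right.2 (Set.subset_inter hgen (genericPairs_subset_biconicLift L))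
  rw [hψ.subspace_eq_inter_genericPairs L hM hML h0, hψ.subspace_generic L
    (hM.inter (isBiconic_genericPairs L)) Set.inter_subset_right, hc]
  congr 1
  refine measureReal_congr ?_
  filter_upwards [ae_orthogonalSplit_mem_genericPairs L] with g hg
  exact propext ⟨fun h => h.1, fun h => ⟨h, hg⟩⟩

end IsLocalInvariant

end Subspaces

/-! ### Moreau decomposition and faces of polyhedral cones -/

section Cones

variable {d : ℕ}

theorem PolyCone.isClosed (C : PolyCone d) : IsClosed C.carrier := by
  obtain ⟨m, a, h⟩ := C.2
  rw [PolyCone.carrier, h]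
  have : {x : Euc d | ∀ i, inner ℝ (a i) x ≤ 0} = ⋂ i, {x | inner ℝ (a i) x ≤ 0} := by
    ext; simp
  rw [this]
  exact isClosed_iInter fun i => isClosed_le (by fun_prop) continuous_const

theorem PolyCone.exists_mem_iff (C : PolyCone d) : ∃ (m : ℕ) (a : Fin m → Euc d),
    ∀ x, x ∈ C.carrier ↔ ∀ i, inner ℝ (a i) x ≤ 0 := by
  obtain ⟨m, a, h⟩ := C.2
  exact ⟨m, a, fun x => by rw [PolyCone.carrier, h]; rfl⟩

theorem PolyCone.zero_mem (C : PolyCone d) : (0 : Euc d) ∈ C.carrier := by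
  obtain ⟨m, a, h⟩ := C.exists_mem_iff
  simp [h]

theorem PolyCone.add_mem (C : PolyCone d) {x y : Euc d} (hx : x ∈ C.carrier)
    (hy : y ∈ C.carrier) : x + y ∈ C.carrier := by
  obtain ⟨m, a, h⟩ := C.exists_mem_iff
  rw [h] at *
  intro i
  rw [inner_add_right]
  exact add_nonpos (hx i) (hy i)

theorem PolyCone.smul_mem (C : PolyCone d) {x : Euc d} {t : ℝ} (ht : 0 ≤ t)
    (hx : x ∈ C.carrier) : t • x ∈ C.carrier := by
  obtain ⟨m, a, h⟩ := C.exists_mem_iff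
  rw [h] at *
  intro i
  rw [real_inner_smul_right]
  exact mul_nonpos_of_nonneg_of_nonpos ht (hx i)

theorem PolyCone.convex (C : PolyCone d) : Convex ℝ C.carrier :=
  fun _ hx _ hy _ _ ha hb _ => C.add_mem (C.smul_mem ha hx) (C.smul_mem hb hy)

theorem polarCone_add_mem {C : Set (Euc d)} {z w : Euc d} (hz : z ∈ polarCone C)
    (hw : w ∈ polarCone C) : z + w ∈ polarCone C := fun x hx => by
  rw [inner_add_right]
  exact add_nonpos (hz x hx) (hw x hx)

theorem polarCone_smul_mem {C : Set (Euc d)} {z : Euc d} {t : ℝ} (ht : 0 ≤ t)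
    (hz : z ∈ polarCone C) : t • z ∈ polarCone C := fun x hx => by
  rw [real_inner_smul_right]
  exact mul_nonpos_of_nonneg_of_nonpos ht (hz x hx)

theorem convex_polarCone (C : Set (Euc d)) : Convex ℝ (polarCone C) :=
  fun _ hx _ hy _ _ ha hb _ => polarCone_add_mem (polarCone_smul_mem ha hx)
    (polarCone_smul_mem hb hy)

theorem isClosed_polarCone (C : Set (Euc d)) : IsClosed (polarCone C) := by
  have : polarCone C = ⋂ x ∈ C, {z | inner ℝ x z ≤ 0} := by
    ext; simp [polarCone]
  rw [this]
  exact isClosed_biInter fun x _ => isClosed_le (by fun_prop) continuous_const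

theorem isBiconic_biconicLift (C : PolyCone d) : IsBiconic (biconicLift C) := by
  refine isBiconic_of_forall_smul_mem ?_ fun s t hs ht x z h =>
    ⟨C.smul_mem hs.le h.1, polarCone_smul_mem ht.le h.2.1, ?_⟩
  · exact (measurable_fst C.isClosed.measurableSet).inter
      ((measurable_snd (isClosed_polarCone C.carrier).measurableSet).inter
        (measurableSet_eq_fun (by fun_prop) (by fun_prop)))
  · simp only [real_inner_smul_left, real_inner_smul_right]
    rw [show inner ℝ x z = 0 from h.2.2, mul_zero, mul_zero]

theorem zero_mem_biconicLift (C : PolyCone d) : 0 ∈ biconicLift C :=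
  ⟨C.zero_mem, fun x _ => by simp, by simp⟩

/-- A decomposition `x + z` with `(x, z)` in the biconic lift is the Moreau decomposition. -/
theorem nearestPt_add_of_mem_biconicLift {C : PolyCone d} {x z : Euc d}
    (h : (x, z) ∈ biconicLift C) :
    nearestPt C.carrier (x + z) = x ∧ nearestPt (polarCone C.carrier) (x + z) = z := by
  have key : ∀ u v w : Euc d, inner ℝ u v = 0 → inner ℝ w v ≤ 0 → ‖u + v - u‖ ≤ ‖u + v - w‖ := by
    intro u v w huv hwv
    rw [add_sub_cancel_left, show u + v - w = v + (u - w) by abel]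
    have e := norm_add_sq_real v (u - w)
    rw [inner_sub_right, real_inner_comm u v, huv,
      real_inner_comm w v] at e
    refine (sq_le_sq₀ (norm_nonneg _) (norm_nonneg _)).1 ?_
    nlinarith [sq_nonneg ‖u - w‖]
  obtain ⟨hx, hz, hxz⟩ := h
  constructor
  · exact (IsNearestPoint.eq_nearestPt C.isClosed C.convex
      ⟨hx, fun w hw => key x z w hxz (hz w hw)⟩).symm
  · refine (IsNearestPoint.eq_nearestPt (isClosed_polarCone _) (convex_polarCone _)
      ⟨hz, fun w hw => ?_⟩).symm
    rw [add_comm x z]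
    exact key z x w (by rw [real_inner_comm]; exact hxz) (by rw [real_inner_comm]; exact hw x hx)

/-- Moreau decomposition: the nearest points of `C` and its polar lie in the biconic lift. -/
theorem nearestPt_sub_mem_biconicLift (C : PolyCone d) (g : Euc d) :
    (nearestPt C.carrier g, g - nearestPt C.carrier g) ∈ biconicLift C := by
  obtain ⟨hy, hmin⟩ := nearestPt_spec C.isClosed ⟨0, C.zero_mem⟩ g
  set y := nearestPt C.carrier g
  have hvar : ∀ w ∈ C.carrier, inner ℝ (g - y) (w - y) ≤ 0 := by
    have : Nonempty C.carrier := ⟨⟨y, hy⟩⟩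
    refine (norm_eq_iInf_iff_real_inner_le_zero C.convex hy).1 (le_antisymm ?_ ?_)
    · exact le_ciInf fun w => hmin w w.2
    · exact ciInf_le (f := fun w : C.carrier => ‖g - w‖)
        ⟨0, by rintro _ ⟨w, rfl⟩; exact norm_nonneg _⟩ ⟨y, hy⟩
  -- Testing the variational inequality at `w + y` gives polarity; testing it at `0` then gives
  -- orthogonality.
  have hle : ∀ w ∈ C.carrier, inner ℝ w (g - y) ≤ 0 := fun w hw => by
    have := hvar (w + y) (C.add_mem hw hy)
    rwa [add_sub_cancel_right, real_inner_comm] at this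
  refine ⟨hy, hle, le_antisymm (hle y hy) ?_⟩
  have := hvar 0 C.zero_mem
  rw [zero_sub, inner_neg_right, real_inner_comm] at this
  change 0 ≤ inner ℝ y (g - y)
  linarith

theorem nearestPt_polarCone (C : PolyCone d) (g : Euc d) :
    nearestPt (polarCone C.carrier) g = g - nearestPt C.carrier g := by
  have := (nearestPt_add_of_mem_biconicLift (nearestPt_sub_mem_biconicLift C g)).2
  rwa [add_sub_cancel] at this

theorem nearestPt_mem_biconicLift (C : PolyCone d) (g : Euc d) :
    (nearestPt C.carrier g, nearestPt (polarCone C.carrier) g) ∈ biconicLift C := by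
  rw [nearestPt_polarCone]
  exact nearestPt_sub_mem_biconicLift C g

theorem mem_interiorIn {L : Submodule ℝ (Euc d)} {C : Set (Euc d)} {x : Euc d} :
    x ∈ interiorIn L C ↔ x ∈ L ∧ ∃ ε > 0, ∀ y ∈ L, ‖y - x‖ < ε → y ∈ C := by
  constructor
  · rintro ⟨⟨x, hx⟩, h, rfl⟩
    obtain ⟨ε, hε, hb⟩ := Metric.mem_nhds_iff.1 (mem_interior_iff_mem_nhds.1 h)
    refine ⟨hx, ε, hε, fun y hy hyx => ?_⟩
    exact hb (show (⟨y, hy⟩ : L) ∈ _ by rwa [Metric.mem_ball, Subtype.dist_eq, dist_eq_norm])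
  · rintro ⟨hx, ε, hε, h⟩
    refine ⟨⟨x, hx⟩, mem_interior_iff_mem_nhds.2 (Metric.mem_nhds_iff.2 ⟨ε, hε, ?_⟩), rfl⟩
    rintro ⟨y, hy⟩ hyx
    exact h y hy (by rwa [Metric.mem_ball, Subtype.dist_eq, dist_eq_norm] at hyx)

theorem measurableSet_interiorIn (L : Submodule ℝ (Euc d)) (C : Set (Euc d)) :
    MeasurableSet (interiorIn L C) :=
  (MeasurableEmbedding.subtype_coe (measurableSet_submodule L)).measurableSet_image.2
    isOpen_interior.measurableSet

/-- The pairs whose first component is in the interior of `C ∩ L` relative to `L`. -/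
def interiorPairs (L : Submodule ℝ (Euc d)) (C : PolyCone d) : Set (Euc d × Euc d) :=
  {p | p.1 ∈ interiorIn L C.carrier}

theorem isBiconic_interiorPairs (L : Submodule ℝ (Euc d)) (C : PolyCone d) :
    IsBiconic (interiorPairs L C) := by
  refine isBiconic_of_forall_smul_mem (measurable_fst (measurableSet_interiorIn L C.carrier))
    fun s t hs _ x z h => ?_
  obtain ⟨hx, ε, hε, hb⟩ := mem_interiorIn.1 h
  refine mem_interiorIn.2 ⟨L.smul_mem _ hx, s * ε, mul_pos hs hε, fun y hy hyx => ?_⟩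
  have := C.smul_mem hs.le (hb (s⁻¹ • y) (L.smul_mem _ hy) ?_)
  · rwa [smul_smul, mul_inv_cancel₀ hs.ne', one_smul] at this
  · have e : s⁻¹ • y - x = s⁻¹ • (y - s • x) := by
      rw [smul_sub, smul_smul, inv_mul_cancel₀ hs.ne', one_smul]
    rw [e, norm_smul, norm_inv, Real.norm_of_nonneg hs.le, inv_mul_lt_iff₀ hs]
    exact hyx

theorem exists_pos_forall_add_smul_mem {L : Submodule ℝ (Euc d)} {C : Set (Euc d)} {x v : Euc d}
    (hx : x ∈ interiorIn L C) (hv : v ∈ L) : ∃ t : ℝ, 0 < t ∧ x + t • v ∈ C := by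
  obtain ⟨hxL, ε, hε, h⟩ := mem_interiorIn.1 hx
  have hpos : 0 < ‖v‖ + 1 := by positivity
  -- The `+ 1` covers `v = 0` and makes the inequality strict.
  refine ⟨ε / (‖v‖ + 1), by positivity, h _ (L.add_mem hxL (L.smul_mem _ hv)) ?_⟩
  rw [add_sub_cancel_left, norm_smul, Real.norm_of_nonneg (by positivity), div_mul_eq_mul_div,
    div_lt_iff₀ hpos]
  nlinarith

/-- Pairing with `z` is nonpositive on `C` and attains its maximum 0 at `x`, from which one can move
within `C` in every direction of `L`. -/
theorem mem_orthogonal_of_mem_interiorIn {L : Submodule ℝ (Euc d)} {C : Set (Euc d)} {x z : Euc d}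
    (hx : x ∈ interiorIn L C) (hz : z ∈ polarCone C) (hxz : inner ℝ x z = 0) : z ∈ Lᗮ := by
  have key : ∀ v ∈ L, inner ℝ v z ≤ 0 := fun v hv => by
    obtain ⟨t, ht, h⟩ := exists_pos_forall_add_smul_mem hx hv
    have := hz _ h
    rw [inner_add_left, hxz, real_inner_smul_left, zero_add] at this
    exact nonpos_of_mul_nonpos_right this ht
  refine (Submodule.mem_orthogonal _ _).2 fun v hv => le_antisymm (key v hv) ?_
  have := key (-v) (L.neg_mem hv)
  rw [inner_neg_left] at this
  linarith

/-- The linear spans of the faces of `C`. -/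
def allFaceSpans (C : Set (Euc d)) : Set (Submodule ℝ (Euc d)) :=
  {L | ∃ F, IsConeFace C F ∧ L = Submodule.span ℝ F}

/-- The normal `w` of the first face vanishes at `x`, hence is orthogonal to `L'`, so the second
face is contained in the first. -/
theorem le_of_interiorIn_inter {C : Set (Euc d)} {L L' : Submodule ℝ (Euc d)}
    (hL : L ∈ allFaceSpans C) (hL' : L' ∈ allFaceSpans C) {x : Euc d} (hx : x ∈ interiorIn L C)
    (hx' : x ∈ interiorIn L' C) : L' ≤ L := by
  obtain ⟨F, ⟨w, hw, rfl⟩, rfl⟩ := hL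
  obtain ⟨F', ⟨w', hw', rfl⟩, rfl⟩ := hL'
  have hxw : inner ℝ x w = 0 := by
    have hle : Submodule.span ℝ {x | x ∈ C ∧ inner ℝ x w = 0} ≤ (ℝ ∙ w)ᗮ :=
      Submodule.span_le.2 fun y hy => Submodule.mem_orthogonal_singleton_iff_inner_left.2 hy.2
    exact Submodule.mem_orthogonal_singleton_iff_inner_left.1 (hle (mem_interiorIn.1 hx).1)
  have hwL := mem_orthogonal_of_mem_interiorIn hx' hw hxw
  refine Submodule.span_le.2 fun y hy => Submodule.subset_span ⟨hy.1, ?_⟩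
  exact Submodule.inner_right_of_mem_orthogonal (Submodule.subset_span hy) hwL

theorem eq_of_interiorIn_inter {C : Set (Euc d)} {L L' : Submodule ℝ (Euc d)}
    (hL : L ∈ allFaceSpans C) (hL' : L' ∈ allFaceSpans C) {x : Euc d} (hx : x ∈ interiorIn L C)
    (hx' : x ∈ interiorIn L' C) : L = L' :=
  le_antisymm (le_of_interiorIn_inter hL' hL hx' hx) (le_of_interiorIn_inter hL hL' hx hx')

theorem mem_of_forall_near_mem {V W : Submodule ℝ (Euc d)} {x v : Euc d} {ε : ℝ}
    (hε : 0 < ε) (hx : x ∈ V) (h : ∀ y ∈ V, ‖y - x‖ < ε → y ∈ W) (hv : v ∈ V) : v ∈ W := by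
  obtain ⟨t, ht, hmem⟩ := exists_pos_forall_add_smul_mem (C := (W : Set (Euc d)))
    (mem_interiorIn.2 ⟨hx, ε, hε, h⟩) hv
  have := W.sub_mem hmem (h x hx (by simpa))
  rw [add_sub_cancel_left] at this
  exact (W.smul_mem_iff ht.ne').1 this

/-- Every point of a polyhedral cone lies in the relative interior of a face, which spans the
subspace where the constraints active at that point vanish. -/
theorem mem_interiorIn_active {m : ℕ} (a : Fin m → Euc d) {x : Euc d}
    (hx : ∀ i, inner ℝ (a i) x ≤ 0) :
    (Submodule.span ℝ (a '' {i | inner ℝ (a i) x = 0}))ᗮ ∈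
        allFaceSpans {x : Euc d | ∀ i, inner ℝ (a i) x ≤ 0} ∧
      x ∈ interiorIn (Submodule.span ℝ (a '' {i | inner ℝ (a i) x = 0}))ᗮ
        {x : Euc d | ∀ i, inner ℝ (a i) x ≤ 0} := by
  classical
  set V := (Submodule.span ℝ (a '' {i | inner ℝ (a i) x = 0}))ᗮ with hVdef
  have hV : ∀ y, y ∈ V ↔ ∀ i, inner ℝ (a i) x = 0 → inner ℝ (a i) y = 0 := by
    intro y
    rw [hVdef, Submodule.mem_orthogonal]
    constructor
    · exact fun h i hi => h _ (Submodule.subset_span ⟨i, hi, rfl⟩)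
    · intro h u hu
      induction hu using Submodule.span_induction with
      | mem u hu => obtain ⟨i, hi, rfl⟩ := hu; exact h i hi
      | zero => simp
      | add u v _ _ h1 h2 => rw [inner_add_left, h1, h2, add_zero]
      | smul c u _ h1 => rw [real_inner_smul_left, h1, mul_zero]
  have hxV : x ∈ V := (hV x).2 fun _ h => h
  obtain ⟨ε, hε, hball⟩ : ∃ ε > 0, ∀ y, ‖y - x‖ < ε → ∀ i, inner ℝ (a i) x ≠ 0 →
      inner ℝ (a i) y ≤ 0 := by
    -- Inactive constraints are strict at `x` and stay so nearby.
    have hopen : IsOpen (⋂ i, {y : Euc d | inner ℝ (a i) x ≠ 0 → inner ℝ (a i) y < 0}) := by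
      refine isOpen_iInter_of_finite fun i => ?_
      by_cases hi : inner ℝ (a i) x = 0
      · simp [hi]
      · simpa [hi] using isOpen_lt (by fun_prop) continuous_const
    obtain ⟨ε, hε, hb⟩ := Metric.isOpen_iff.1 hopen x
      (Set.mem_iInter.2 fun i hi => lt_of_le_of_ne (hx i) hi)
    refine ⟨ε, hε, fun y hy i hi => ?_⟩
    have := hb (show y ∈ Metric.ball x ε by rwa [Metric.mem_ball, dist_eq_norm])
    exact (Set.mem_iInter.1 this i hi).le
  have hnear : ∀ y ∈ V, ‖y - x‖ < ε → ∀ i, inner ℝ (a i) y ≤ 0 := fun y hy hyx i => by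
    by_cases hi : inner ℝ (a i) x = 0
    · exact ((hV y).1 hy i hi).le
    · exact hball y hyx i hi
  refine ⟨?_, mem_interiorIn.2 ⟨hxV, ε, hε, hnear⟩⟩
  -- On the cone every term of the sum is nonpositive, so pairing with `z` vanishes exactly where
  -- all active constraints do.
  set z := ∑ i with inner ℝ (a i) x = 0, a i with hz
  have hinner : ∀ y, inner ℝ y z = ∑ i with inner ℝ (a i) x = 0, inner ℝ (a i) y := fun y => by
    rw [hz, inner_sum]
    exact Finset.sum_congr rfl fun i _ => real_inner_comm _ _
  refine ⟨_, ⟨z, fun y hy => ?_, rfl⟩, le_antisymm ?_ ?_⟩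
  · rw [hinner]
    exact Finset.sum_nonpos fun i _ => hy i
  · intro v hv
    refine mem_of_forall_near_mem hε hxV (fun y hy hyx => Submodule.subset_span
      ⟨hnear y hy hyx, ?_⟩) hv
    rw [hinner]
    exact Finset.sum_eq_zero fun i hi => (hV y).1 hy i (Finset.mem_filter.1 hi).2
  · refine Submodule.span_le.2 fun y hy => (hV y).2 fun i hi => ?_
    have h0 := hy.2
    rw [hinner, Finset.sum_eq_zero_iff_of_nonpos fun i _ => hy.1 i] at h0
    exact h0 i (by simpa using hi)

/-- The spans of the faces of `C` with nonempty relative interior. -/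
def faceSubspaces (C : PolyCone d) : Set (Submodule ℝ (Euc d)) :=
  {L | L ∈ allFaceSpans C.carrier ∧ (interiorIn L C.carrier).Nonempty}

/-- Each such span is determined by the set of constraints active at one interior point. -/
theorem finite_faceSubspaces (C : PolyCone d) : (faceSubspaces C).Finite := by
  obtain ⟨m, a, h⟩ := C.2
  refine (Set.finite_range fun I : Set (Fin m) => (Submodule.span ℝ (a '' I))ᗮ).subset ?_
  rintro L ⟨hL, x, hx⟩
  obtain ⟨hxL, ε, hε, hb⟩ := mem_interiorIn.1 hx
  have hxC : x ∈ C.carrier := hb x hxL (by simpa)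
  rw [PolyCone.carrier, h] at hL hx hxC
  obtain ⟨h1, h2⟩ := mem_interiorIn_active a hxC
  exact ⟨_, eq_of_interiorIn_inter h1 hL h2 hx⟩

theorem exists_faceSubspace (C : PolyCone d) {x : Euc d} (hx : x ∈ C.carrier) :
    ∃ L ∈ faceSubspaces C, x ∈ interiorIn L C.carrier := by
  obtain ⟨m, a, h⟩ := C.2
  have hx' := hx
  rw [PolyCone.carrier, h] at hx'
  obtain ⟨h1, h2⟩ := mem_interiorIn_active a hx'
  rw [← h] at h1 h2
  exact ⟨_, ⟨h1, x, h2⟩, h2⟩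

end Cones

/-! ### Assembling the faces -/

section Characterization

variable {d : ℕ}

/-- For `M` in the biconic lift, the orthogonal components in the span of a face and the nearest
points determine the same event over that face. -/
theorem orthogonalSplit_mem_iff {C : PolyCone d} {L : Submodule ℝ (Euc d)}
    {M : Set (Euc d × Euc d)} (hMC : M ⊆ biconicLift C) (g : Euc d) :
    orthogonalSplit L g ∈ M ∩ interiorPairs L C ↔
      nearestPt C.carrier g ∈ interiorIn L C.carrier ∧
        (nearestPt C.carrier g, nearestPt (polarCone C.carrier) g) ∈ M := by
  constructor
  · rintro ⟨hM, hint⟩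
    obtain ⟨h1, h2⟩ := nearestPt_add_of_mem_biconicLift (hMC hM)
    rw [L.starProjection_add_starProjection_orthogonal] at h1 h2
    rw [h1, h2]
    exact ⟨hint, hM⟩
  · rintro ⟨hint, hM⟩
    have hz := mem_orthogonal_of_mem_interiorIn hint (hMC hM).2.1 (hMC hM).2.2
    have e := orthogonalSplit_add (mem_interiorIn.1 hint).1 hz
    rw [nearestPt_polarCone, add_sub_cancel, ← nearestPt_polarCone] at e
    rw [e]
    exact ⟨hM, hint⟩

theorem inter_interiorPairs_subset {C : PolyCone d} {L : Submodule ℝ (Euc d)}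
    {M : Set (Euc d × Euc d)} (hMC : M ⊆ biconicLift C) :
    M ∩ interiorPairs L C ⊆ biconicLift (PolyCone.ofSubspace L) := fun _ hp =>
  mem_biconicLift_ofSubspace.2 ⟨(mem_interiorIn.1 hp.2).1,
    mem_orthogonal_of_mem_interiorIn hp.2 (hMC hp.1).2.1 (hMC hp.1).2.2⟩

theorem pairwiseDisjoint_interiorPairs (C : PolyCone d) :
    (faceSubspaces C).PairwiseDisjoint fun L => interiorPairs L C := by
  intro L hL L' hL' hne
  refine Set.disjoint_left.2 fun p hp hp' => hne ?_
  exact eq_of_interiorIn_inter hL.1 hL'.1 hp hp'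

theorem biUnion_inter_interiorPairs {C : PolyCone d} {M : Set (Euc d × Euc d)}
    (hMC : M ⊆ biconicLift C) :
    ⋃ L ∈ (finite_faceSubspaces C).toFinset, M ∩ interiorPairs L C = M := by
  ext p
  simp only [Set.Finite.mem_toFinset, Set.mem_iUnion, exists_prop]
  constructor
  · rintro ⟨L, -, h⟩
    exact h.1
  · intro hp
    obtain ⟨L, hL, h⟩ := exists_faceSubspace C (hMC hp).1
    exact ⟨L, hL, hp, h⟩

/-- The `k`-skeleton is the disjoint union of the relative interiors of the `k`-dimensional faces;
over each of them the nearest points are the orthogonal components. -/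
theorem supportMeasure_eq_sum {C : PolyCone d} {M : Set (Euc d × Euc d)} (hM : IsBiconic M)
    (hMC : M ⊆ biconicLift C) (k : ℕ) :
    supportMeasure k C M =
      ∑ L ∈ (finite_faceSubspaces C).toFinset.filter
          (fun L : Submodule ℝ (Euc d) => Module.finrank ℝ L = k),
        (stdGaussian (Euc d)).real {g | orthogonalSplit L g ∈ M ∩ interiorPairs L C} := by
  rw [← measureReal_biUnion_finset]
  · unfold supportMeasure
    congr 1
    ext g
    simp only [orthogonalSplit_mem_iff hMC, skeleton, Set.mem_iUnion, Finset.mem_filter,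
      Set.Finite.mem_toFinset, Set.mem_ofPred_eq, exists_prop]
    constructor
    · rintro ⟨⟨L, ⟨F, hF, hL, hk⟩, h⟩, hM⟩
      exact ⟨L, ⟨⟨⟨F, hF, hL⟩, _, h⟩, hk⟩, h, hM⟩
    · rintro ⟨L, ⟨⟨⟨F, hF, hL⟩, -⟩, hk⟩, h, hM⟩
      exact ⟨⟨L, ⟨F, hF, hL, hk⟩, h⟩, hM⟩
  · intro L hL L' hL' hne
    refine Set.disjoint_left.2 fun g hg hg' => hne ?_
    have h1 := ((orthogonalSplit_mem_iff hMC g).1 hg).1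
    have h2 := ((orthogonalSplit_mem_iff hMC g).1 hg').1
    simp only [Finset.coe_filter, Set.Finite.mem_toFinset, Set.mem_ofPred_eq] at hL hL'
    exact eq_of_interiorIn_inter hL.1.1 hL'.1.1 h1 h2
  · exact fun L _ => measurable_orthogonalSplit L (hM.inter (isBiconic_interiorPairs L C)).1

/-- The nearest points of `g` always form a pair of the lift, and they sum to `g`, which is almost
surely nonzero when `d > 0`. -/
theorem supportMeasure_inter_diff [NeZero d] (k : ℕ) (C : PolyCone d) (M : Set (Euc d × Euc d)) :
    supportMeasure k C ((M ∩ biconicLift C) \ {0}) = supportMeasure k C M := by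
  refine measureReal_congr ?_
  have h0 : ∀ᵐ g ∂stdGaussian (Euc d), g ≠ 0 := by
    have := ae_starProjection_ne_zero (E := Euc d) (L := ⊤) top_ne_bot
    simpa [Submodule.starProjection_top] using this
  filter_upwards [h0] with g hg
  refine propext ⟨fun h => ⟨h.1, h.2.1.1⟩, fun h => ⟨h.1, ⟨h.2, nearestPt_mem_biconicLift C g⟩,
    fun h0 => hg ?_⟩⟩
  obtain ⟨h1, h2⟩ := Prod.mk.inj h0
  rwa [nearestPt_polarCone, h1, sub_zero] at h2

namespace IsLocalInvariant

variable {ψ : PolyCone d → BiconicMeasure d}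

theorem eq_sum_of_subset_biconicLift (hψ : IsLocalInvariant ψ) [NeZero d]
    (L : Fin (d + 1) → Submodule ℝ (Euc d)) (hL : ∀ k, Module.finrank ℝ (L k) = k)
    (C : PolyCone d) {M : Set (Euc d × Euc d)} (hM : IsBiconic M) (hMC : M ⊆ biconicLift C)
    (h0 : 0 ∉ M) :
    ψ C M = ∑ k : Fin (d + 1), ψ (PolyCone.ofSubspace (L k)) {0}ᶜ * supportMeasure k C M := by
  have hfin : ∀ V : Submodule ℝ (Euc d), Module.finrank ℝ V < d + 1 := fun V =>
    Nat.lt_succ_of_le (by simpa using V.finrank_le)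
  conv_lhs => rw [← biUnion_inter_interiorPairs hMC]
  rw [VectorMeasure.of_biUnion_finset (v := ψ C)
    (fun V hV V' hV' hne => ((pairwiseDisjoint_interiorPairs C) (by simpa using hV)
      (by simpa using hV') hne).mono Set.inter_subset_right Set.inter_subset_right)
    fun V _ => hM.inter (isBiconic_interiorPairs V C),
    -- Group the faces by dimension.
    ← Finset.sum_fiberwise _ fun V : Submodule ℝ (Euc d) =>
      (⟨Module.finrank ℝ V, hfin V⟩ : Fin (d + 1))]
  refine Finset.sum_congr rfl fun k _ => ?_
  rw [supportMeasure_eq_sum hM hMC, Finset.mul_sum]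
  simp only [Fin.ext_iff]
  refine Finset.sum_congr rfl fun V hV => ?_
  have hMV := hM.inter (isBiconic_interiorPairs V C)
  have hsub := inter_interiorPairs_subset (L := V) hMC
  rw [hψ.congr hMV (Set.inter_subset_left.trans hMC) hsub,
    hψ.subspace_eq_mul V hMV hsub fun h => h0 h.1,
    hψ.compl_zero_of_finrank_eq ((Finset.mem_filter.1 hV).2.trans (hL k).symm)]

theorem apply_inter_zero (hψ : IsLocalInvariant ψ) (C : PolyCone d) {M : Set (Euc d × Euc d)} :
    ψ C (M ∩ {0}) = ψ (PolyCone.ofSubspace ⊤) {0} * biDirac M := by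
  by_cases h0 : (0 : Euc d × Euc d) ∈ M
  · rw [Set.inter_eq_right.2 (Set.singleton_subset_iff.2 h0), hψ.congr isBiconic_zero
      (Set.singleton_subset_iff.2 (zero_mem_biconicLift C))
      (Set.singleton_subset_iff.2 (zero_mem_biconicLift (PolyCone.ofSubspace ⊤)))]
    simp [biDirac, measureReal_def, h0]
  · rw [Set.inter_singleton_eq_empty.2 h0, VectorMeasure.empty]
    simp [biDirac, measureReal_def, h0]

theorem eq_sum (hψ : IsLocalInvariant ψ) (L : Fin (d + 1) → Submodule ℝ (Euc d))
    (hL : ∀ k, Module.finrank ℝ (L k) = k) (C : PolyCone d) {M : Set (Euc d × Euc d)}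
    (hM : IsBiconic M) :
    ψ C M = ψ (PolyCone.ofSubspace ⊤) {0} * biDirac M +
      ∑ k : Fin (d + 1), ψ (PolyCone.ofSubspace (L k)) {0}ᶜ * supportMeasure k C M := by
  rw [@signedMeasure_eq_inter_add_diff _ (biconicAlgebra d) (ψ C) _ _ isBiconic_zero hM,
    hψ.apply_inter_zero C]
  congr 1
  -- For `d = 0` the origin is the only pair, so the remaining mass and all coefficients `ψ
  -- (PolyCone.ofSubspace (L k)) {0}ᶜ` vanish.
  rcases Nat.eq_zero_or_pos d with rfl | hd
  · have h1 : M \ {0} = ∅ := Set.eq_empty_of_forall_notMem fun p hp => hp.2 (Subsingleton.elim _ _)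
    have h2 : ({0}ᶜ : Set (Euc 0 × Euc 0)) = ∅ :=
      Set.eq_empty_of_forall_notMem fun p hp => hp (Subsingleton.elim _ _)
    simp [h1, h2]
  · have : NeZero d := ⟨hd.ne'⟩
    have hN := hM.inter (isBiconic_biconicLift C)
    have e : M \ {0} ∩ biconicLift C = (M ∩ biconicLift C) \ {0} := by
      ext; simp only [Set.mem_inter_iff, Set.mem_sdiff]; tauto
    rw [hψ.concentrated C _ (hM.diff isBiconic_zero), e, hψ.eq_sum_of_subset_biconicLift L hL C
      (hN.diff isBiconic_zero) (Set.sdiff_subset.trans Set.inter_subset_right) fun h => h.2 rfl]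
    simp only [supportMeasure_inter_diff]

end IsLocalInvariant

end Characterization

theorem mainTheorem4 (d : ℕ) (ψ : PolyCone d → BiconicMeasure d)
    (concentrated : ∀ (C : PolyCone d) (M : Set (Euc d × Euc d)), IsBiconic M →
      ψ C M = ψ C (M ∩ biconicLift C))
    (invariant : ∀ (Q : Euc d ≃ₗᵢ[ℝ] Euc d) (C : PolyCone d) (M : Set (Euc d × Euc d)),
      IsBiconic M → ψ (C.map Q) (biRotate Q M) = ψ C M)
    (local_on_lift : ∀ (C D : PolyCone d) (M : Set (Euc d × Euc d)), IsBiconic M →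
      biconicLift C ∩ M = biconicLift D ∩ M → ψ C M = ψ D M) :
    (∃ (r : ℝ) (c : Fin (d + 1) → ℝ), ∀ (C : PolyCone d) (M : Set (Euc d × Euc d)),
      IsBiconic M → ψ C M = r * biDirac M + ∑ k : Fin (d + 1), c k * supportMeasure k C M) ∧
    ∀ L : Fin (d + 1) → Submodule ℝ (Euc d), (∀ k, Module.finrank ℝ (L k) = k) →
      ∀ (C : PolyCone d) (M : Set (Euc d × Euc d)), IsBiconic M →
        ψ C M = ψ (PolyCone.ofSubspace ⊤) {0} * biDirac M +
          ∑ k : Fin (d + 1),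
            ψ (PolyCone.ofSubspace (L k)) {0}ᶜ * supportMeasure k C M := by
  have hψ : IsLocalInvariant ψ := ⟨concentrated, invariant, local_on_lift⟩
  choose L hL using fun k : Fin (d + 1) => exists_submodule_finrank_eq (Nat.le_of_lt_succ k.2)
  exact ⟨⟨_, _, fun C M hM => hψ.eq_sum L hL C hM⟩, fun L hL C M hM => hψ.eq_sum L hL C hM⟩
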